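/- Let $0<q<1$, $0<qa<1$, $b<q^{-1}$ with $a,b\in\mathbb{R}$, and let $c\in\mathbb{C}\setminus\{0\}$ be such that \[ \gamma=(1+abq^2)-\Bigl(acq+\frac{bq}{c}\Bigr)\in\mathbb{R} \] and such that \[ \Lambda_n^\gamma = q^{-n}(1-q^n)(1-abq^{n+2})+\gamma = q^{-n}(1-acq^{n+1})\Bigl(1-\frac{bq^{n+1}}{c}\Bigr)>0\qquad\text{for all } n\in\mathbb{N}=\{0,1,2,\dots\}. \] Let $\nu=\sum_{k=0}^\infty w_k\,\delta_{q^k}$ be the orthogonality measure of the little $q$-Jacobi polynomials, where \[ w_k=\frac{(qb;q)_k}{(q;q)_k}(aq)^k,\qquad (x;q)_k=\prod_{j=0}^{k-1}(1-xq^j). \] Then the second-order $q$-difference operator \[ (T^\gamma f)(x)=aq(bqx-1)\bigl(f(qx)-f(x)\bigr)+(x-1)\bigl(f(q^{-1}x)-f(x)\bigr)+\gamma x f(x),\qquad x\in q^{\mathbb{N}}, \] where the second term is $0$ at $x=1$, defines a bounded self-adjoint operator on the complex Hilbert space $L^2(\nu)$. It has simple spectrum, i.e. there is a vector $\xi\in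 L^2(\nu)$ such that the linear span of $\{(T^\gamma)^n\xi : n\in\mathbb{N}\}$ is dense, and its spectrum is \[ \begin{split} [(1-\sqrt{aq})^2,(1+\sqrt{aq})^2] &\cup\bigl\{(1-q^{-k}/c)(1-acq^{1+k}) \,:\, k\in\mathbb{N},\ |q^{k}c\sqrt{aq}|>1\bigr\}\\ &\cup\Bigl\{(1-bq^{l+1}/c)(1-acq^{-l}/b)\,:\, l\in\mathbb{N},\ \Bigl|q^l\frac{b}{c}\sqrt{\frac{q}{a}}\Bigr|>1\Bigr\}, \end{split} \] where the last set is empty if $b=0$. -/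

import Mathlib

open MeasureTheory

/-- The `q`-shifted factorial `(x; q)_k = ∏_{j < k} (1 - x q^j)`. -/
noncomputable def qShiftedFactorial (x q : ℝ) (k : ℕ) : ℝ :=
  ∏ j ∈ Finset.range k, (1 - x * q ^ j)

/-- The weights `w_k(a, b; q) = (qb; q)_k / (q; q)_k * (aq)^k` of the little `q`-Jacobi
polynomials. -/
noncomputable def littleQJacobiWeight (q a b : ℝ) (k : ℕ) : ℝ :=
  qShiftedFactorial (q * b) q k / qShiftedFactorial q q k * (a * q) ^ k

/-- The orthogonality measure `ν = ∑_k w_k(a, b; q) δ_{q^k}` of the little `q`-Jacobi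
polynomials `p_n(·; a, b; q)`. -/
noncomputable def littleQJacobiMeasure (q a b : ℝ) : Measure ℝ :=
  Measure.sum fun k : ℕ =>
    ENNReal.ofReal (littleQJacobiWeight q a b k) • Measure.dirac (q ^ k)

/-- The eigenvalues `Λ_n(a, b; q) = q^{-n} (1 - q^n) (1 - a b q^{n+1})` of the second order
`q`-difference operator having the little `q`-Jacobi polynomials `p_n(·; a, b; q)` as
eigenfunctions. -/
noncomputable def littleQJacobiEigenvalue (q a b : ℝ) (n : ℕ) : ℝ :=
  (q ^ n)⁻¹ * (1 - q ^ n) * (1 - a * b * q ^ (n + 1))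

/-- The second order `q`-difference operator
`(T^γ f)(x) = aq(bqx - 1)(f(qx) - f(x)) + (x - 1)(f(q⁻¹x) - f(x)) + γ x f(x)`
as an operation on functions. For `x = q^k` with `k ≥ 0` only values of `f` on `{q^j : j ≥ 0}`
enter, as the factor `x - 1` vanishes at `x = 1`. -/
noncomputable def qDifferenceOp (q a b γ : ℝ) (f : ℝ → ℂ) (x : ℝ) : ℂ :=
  ((a * q * (b * q * x - 1) : ℝ) : ℂ) * (f (q * x) - f x)
    + ((x - 1 : ℝ) : ℂ) * (f (q⁻¹ * x) - f x)
    + ((γ * x : ℝ) : ℂ) * f x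

/-- A bounded (self-adjoint) operator on a Hilbert space has simple spectrum if it has a cyclic
vector: some `ξ` for which the linear span of `ξ, Tξ, T²ξ, …` is dense. -/
def HasSimpleSpectrum {H : Type*} [NormedAddCommGroup H] [InnerProductSpace ℂ H]
    (T : H →L[ℂ] H) : Prop :=
  ∃ ξ : H, Dense (Submodule.span ℂ (Set.range fun n : ℕ => (T ^ n) ξ) : Set H)

/-!
The operator `T^γ` couples only neighbouring points `q ^ k`, `q ^ (k + 1)`, and
`w_k A_k = w_{k+1} B_{k+1}` for its coefficients `A`, `B` and the weights `w`. Hence in the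
orthonormal basis of normalized indicator functions of the atoms (`atomBasis`) it becomes a Jacobi
operator on `ℓ²`. With `σ = √(aq)` it equals `1 + aq - σ X`
(`pullOp_ae_eq_qDifferenceOp`), where `X` is the Jacobi operator `ascOp` of the Al-Salam–Chihara
polynomials with parameters `α = cσ`, `β = (b / c) √(q / a)`, so that `αβ = qb < 1`: its diagonal
is `(α + β) q ^ k` and its off-diagonal entries are `√((1 - q ^ (k + 1)) (1 - αβ q ^ k))`. These
entries do not vanish, so the first basis vector is cyclic (`dense_span_jacobiOp_pow`).

Since the diagonal tends to `0` and the off-diagonal to `1`, `X` is a compact perturbation of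
`S + S⋆`, with `S` the unilateral shift. Writing spectral values as `z + z⁻¹` with `|z| ≤ 1`, this
gives two facts about such Jacobi operators in general. All points with `|z| = 1` are in the
spectrum, by testing with plane waves moved to infinity (`add_inv_mem_spectrum_jacobiOp`). For
`|z| < 1` the operator `z + z⁻¹ - (S + S⋆)` is invertible, so by the Fredholm alternative a spectral
value is an eigenvalue (`exists_eigenvector_jacobiOp`).

The eigenvalues are found from the generating function `G` of the suitably rescaled entries of an
eigenvector, which satisfies
`(1 - z t)(1 - t / z) G(t) = (1 - α t)(1 - β t) G(q t)`. For square-summable eigenvectors `G` is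
analytic in the unit disc. At `t = z` the left side vanishes, and unless `α z q ^ k = 1` or
`β z q ^ k = 1` for some `k`, it follows that `G` vanishes at `z q, z q², …`, hence at `0`, which
forces the eigenvector to be zero (`exists_mul_pow_eq_one_of_eigenvector`). Conversely, if
`α z q ^ k = 1`, then `(α t; q)_k (β t; q)_∞ / (z t; q)_∞` solves the equation and its coefficients
are square-summable (`exists_eigenvector_ascOp`).
-/

open Filter Topology ContinuousLinearMap
open scoped ENNReal InnerProduct InnerProductSpace

/-! ### Shift and diagonal operators on `ℓ²` -/

/-- The Hilbert space `ℓ²(ℕ)` of square-summable complex sequences. -/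
abbrev SeqL2 : Type := lp (fun _ : ℕ => ℂ) 2

/-- The `C⋆`-algebra `ℓ^∞(ℕ)` of bounded complex sequences. -/
abbrev SeqLInf : Type := lp (fun _ : ℕ => ℂ) ∞

section PointwiseOperations

variable {p : ℝ≥0∞} (u v : lp (fun _ : ℕ => ℂ) p) (c : ℂ) (k : ℕ)

theorem seq_zero_apply : (0 : lp (fun _ : ℕ => ℂ) p) k = 0 := rfl

theorem seq_add_apply : (u + v) k = u k + v k := rfl

theorem seq_sub_apply : (u - v) k = u k - v k := rfl

theorem seq_smul_apply : (c • u) k = c * u k := rfl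

theorem seq_one_apply : (1 : SeqLInf) k = 1 := rfl

end PointwiseOperations

-- The coercion lemmas of the library stop at sums of functions; evaluate at a point instead.
attribute [-simp] lp.coeFn_zero lp.coeFn_add lp.coeFn_sub lp.coeFn_smul lp.infty_coeFn_one
attribute [simp] seq_zero_apply seq_add_apply seq_sub_apply seq_smul_apply seq_one_apply

theorem memℓp_two_iff {u : ℕ → ℂ} : Memℓp u 2 ↔ Summable fun n => ‖u n‖ ^ 2 := by
  rw [memℓp_gen_iff (by norm_num)]
  simp

/-- The element of `ℓ²` given by a square-summable sequence. -/
noncomputable def mkSeq (u : ℕ → ℂ) (hu : Summable fun n => ‖u n‖ ^ 2) : SeqL2 :=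
  ⟨u, memℓp_two_iff.2 hu⟩

@[simp]
theorem mkSeq_apply (u : ℕ → ℂ) (hu : Summable fun n => ‖u n‖ ^ 2) (k : ℕ) :
    mkSeq u hu k = u k := rfl

theorem summable_norm_sq (u : SeqL2) : Summable fun n => ‖u n‖ ^ 2 := memℓp_two_iff.1 u.2

theorem norm_sq_eq_tsum (u : SeqL2) : ‖u‖ ^ 2 = ∑' k, ‖u k‖ ^ 2 := by
  simpa using lp.norm_rpow_eq_tsum (p := 2) (by norm_num) u

theorem norm_le_mul_norm {u v : SeqL2} {C : ℝ} (hC : 0 ≤ C) (h : ∀ k, ‖u k‖ ≤ C * ‖v k‖) :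
    ‖u‖ ≤ C * ‖v‖ := by
  have h1 : C * ‖v‖ = ‖(C : ℂ) • v‖ := by
    rw [norm_smul, Complex.norm_real, Real.norm_of_nonneg hC]
  rw [h1]
  refine lp.norm_mono (by simp) fun k => ?_
  rw [seq_smul_apply, norm_mul, Complex.norm_real, Real.norm_of_nonneg hC]
  exact h k

theorem norm_seq_apply_le (d : SeqLInf) (k : ℕ) : ‖d k‖ ≤ ‖d‖ :=
  lp.norm_apply_le_norm (by simp) d k

/-- Multiplication by a bounded sequence, as an operator on `ℓ²`. -/
noncomputable def diagOp (d : SeqLInf) : SeqL2 →L[ℂ] SeqL2 :=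
  LinearMap.mkContinuous
    { toFun := fun u => mkSeq (fun k => d k * u k) (by
        refine Summable.of_nonneg_of_le (fun _ => by positivity) (fun k => ?_)
          ((summable_norm_sq u).mul_left (‖d‖ ^ 2))
        rw [norm_mul, mul_pow]
        gcongr
        exact norm_seq_apply_le d k)
      map_add' := fun u v => by ext k; simp [mul_add]
      map_smul' := fun c u => by ext k; simp [mul_left_comm] }
    ‖d‖ (fun u => by
      refine norm_le_mul_norm (norm_nonneg d) fun k => ?_
      simp only [LinearMap.coe_mk, AddHom.coe_mk, mkSeq_apply, norm_mul]
      gcongr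
      exact norm_seq_apply_le d k)

@[simp]
theorem diagOp_apply (d : SeqLInf) (u : SeqL2) (k : ℕ) : diagOp d u k = d k * u k := rfl

/-- The sequence `(0, u₀, u₁, …)`. -/
def shiftSeq (u : ℕ → ℂ) : ℕ → ℂ
  | 0 => 0
  | k + 1 => u k

theorem summable_shiftSeq (u : SeqL2) : Summable fun n => ‖shiftSeq u n‖ ^ 2 :=
  (summable_nat_add_iff 1).1 (summable_norm_sq u)

/-- The unilateral shift `(u₀, u₁, …) ↦ (0, u₀, u₁, …)`. -/
noncomputable def shiftOp : SeqL2 →ₗᵢ[ℂ] SeqL2 where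
  toFun u := mkSeq (shiftSeq u) (summable_shiftSeq u)
  map_add' u v := by ext (_ | k) <;> simp [shiftSeq]
  map_smul' c u := by ext (_ | k) <;> simp [shiftSeq]
  norm_map' u := by
    rw [← sq_eq_sq₀ (norm_nonneg _) (norm_nonneg _), norm_sq_eq_tsum, norm_sq_eq_tsum]
    simp only [LinearMap.coe_mk, AddHom.coe_mk, mkSeq_apply]
    rw [(summable_shiftSeq u).tsum_eq_zero_add]
    simp [shiftSeq]

@[simp] theorem shiftOp_apply_zero (u : SeqL2) : shiftOp u 0 = 0 := rfl

@[simp] theorem shiftOp_apply_succ (u : SeqL2) (k : ℕ) : shiftOp u (k + 1) = u k := rfl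

theorem norm_shiftOp_iterate (N : ℕ) (v : SeqL2) : ‖shiftOp^[N] v‖ = ‖v‖ := by
  induction N with
  | zero => rfl
  | succ N ih => rw [Function.iterate_succ_apply', LinearIsometry.norm_map, ih]

/-- The standard unit vectors of `ℓ²`. -/
noncomputable def seqUnit (k : ℕ) : SeqL2 := lp.single 2 k 1

theorem seqUnit_apply (k j : ℕ) : seqUnit k j = if j = k then 1 else 0 := by
  simp [seqUnit, Pi.single_apply]

@[simp] theorem norm_seqUnit (k : ℕ) : ‖seqUnit k‖ = 1 := by
  simp [seqUnit, lp.norm_single]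

theorem inner_seqUnit_left (k : ℕ) (u : SeqL2) : ⟪seqUnit k, u⟫_ℂ = u k := by
  simp [seqUnit, lp.inner_single_left]

theorem shiftOp_seqUnit (k : ℕ) : shiftOp (seqUnit k) = seqUnit (k + 1) := by
  ext (_ | j) <;> simp [seqUnit_apply]

/-- The unilateral shift as a bounded operator. -/
noncomputable abbrev shiftCLM : SeqL2 →L[ℂ] SeqL2 := shiftOp.toContinuousLinearMap

@[simp]
theorem adjoint_shiftCLM_apply (u : SeqL2) (k : ℕ) : (shiftCLM†) u k = u (k + 1) := by
  rw [← inner_seqUnit_left, adjoint_inner_right, ← inner_seqUnit_left]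
  simp [shiftOp_seqUnit]

theorem adjoint_shiftCLM_shiftOp (u : SeqL2) : (shiftCLM†) (shiftOp u) = u := by
  ext k; simp

theorem adjoint_diagOp (d : SeqLInf) : (diagOp d)† = diagOp (star d) := by
  ext u k
  rw [← inner_seqUnit_left, adjoint_inner_right]
  simp only [lp.inner_eq_tsum, diagOp_apply, seqUnit_apply]
  rw [tsum_eq_single k (by intro j hj; simp [hj])]
  simp [mul_comm]

/-- A diagonal operator whose entries tend to zero is the norm limit of its finite truncations,
hence compact. -/
theorem isCompactOperator_diagOp {d : SeqLInf} (hd : Tendsto d atTop (𝓝 0)) :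
    IsCompactOperator (diagOp d) := by
  let F : ℕ → SeqL2 →L[ℂ] SeqL2 := fun N => ∑ i ∈ Finset.range N,
    (lp.singleContinuousLinearMap ℂ (fun _ : ℕ => ℂ) 2 i) ∘L
      (d i • (lp.evalCLM ℂ (fun _ : ℕ => ℂ) 2 i))
  have hF : ∀ N u k, F N u k = if k < N then d k * u k else 0 := by
    intro N u k
    simp only [F, _root_.sum_apply, lp.coeFn_sum, Finset.sum_apply]
    simp only [comp_apply, smul_apply, lp.singleContinuousLinearMap_apply, lp.coeFn_single,
      Pi.single_apply, Finset.sum_ite_eq, Finset.mem_range]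
    rfl
  have hFc : ∀ N, IsCompactOperator (F N) := by
    intro N
    refine (compactOperator (RingHom.id ℂ) SeqL2 SeqL2).sum_mem (fun i _ => ?_)
    have h : IsCompactOperator (d i • lp.evalCLM ℂ (fun _ : ℕ => ℂ) 2 i : SeqL2 →L[ℂ] ℂ) :=
      isCompactOperator_of_locallyCompactSpace_dom _
    exact h.clm_comp (lp.singleContinuousLinearMap ℂ (fun _ : ℕ => ℂ) 2 i)
  refine isCompactOperator_of_tendsto (l := atTop) (F := F) ?_ (Eventually.of_forall hFc)
  rw [Metric.tendsto_atTop]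
  intro ε hε
  obtain ⟨N, hN⟩ := Metric.tendsto_atTop.1 hd (ε / 2) (by positivity)
  refine ⟨N, fun n hn => ?_⟩
  rw [dist_eq_norm]
  refine lt_of_le_of_lt (opNorm_le_bound _ (by positivity) fun u => ?_) (half_lt_self hε)
  refine norm_le_mul_norm (by positivity) fun k => ?_
  rw [sub_apply, seq_sub_apply, hF, diagOp_apply]
  split_ifs with h
  · rw [sub_self, norm_zero]
    positivity
  · have := hN k (by omega)
    rw [dist_zero_right] at this
    rw [zero_sub, norm_neg, norm_mul]
    gcongr

/-- Vectors shifted to infinity are annihilated in the limit by a diagonal operator whose entries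
tend to zero. -/
theorem tendsto_diagOp_shiftOp_iterate {d : SeqLInf} (hd : Tendsto d atTop (𝓝 0)) (v : SeqL2) :
    Tendsto (fun N : ℕ => ‖diagOp d (shiftOp^[N] v)‖) atTop (𝓝 0) := by
  have hz : ∀ N k, k < N → shiftOp^[N] v k = 0 := by
    intro N
    induction N with
    | zero => simp
    | succ N ih =>
      intro k hk
      rw [Function.iterate_succ_apply']
      cases k with
      | zero => rfl
      | succ k => exact ih k (by omega)
  rw [Metric.tendsto_atTop]
  intro ε hε
  obtain ⟨N, hN⟩ := Metric.tendsto_atTop.1 hd (ε / (‖v‖ + 1)) (by positivity)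
  refine ⟨N, fun n hn => ?_⟩
  rw [dist_zero_right, norm_norm]
  have h1 : ‖diagOp d (shiftOp^[n] v)‖ ≤ ε / (‖v‖ + 1) * ‖shiftOp^[n] v‖ := by
    refine norm_le_mul_norm (by positivity) fun k => ?_
    rw [diagOp_apply, norm_mul]
    by_cases h : k < n
    · simp [hz n k h]
    · have := hN k (by omega)
      rw [dist_zero_right] at this
      gcongr
  refine h1.trans_lt ?_
  rw [norm_shiftOp_iterate, div_mul_eq_mul_div, div_lt_iff₀ (by positivity)]
  nlinarith [norm_nonneg v]

/-! ### Bounded Jacobi operators -/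

/-- The Jacobi operator on `ℓ²` with diagonal `d` and off-diagonal entries `s`, where `s k` couples
the sites `k` and `k + 1`. -/
noncomputable def jacobiOp (s d : SeqLInf) : SeqL2 →L[ℂ] SeqL2 :=
  shiftCLM ∘L diagOp s + diagOp s ∘L shiftCLM† + diagOp d

theorem jacobiOp_apply_zero (s d : SeqLInf) (u : SeqL2) :
    jacobiOp s d u 0 = s 0 * u 1 + d 0 * u 0 := by
  simp [jacobiOp]

theorem jacobiOp_apply_succ (s d : SeqLInf) (u : SeqL2) (k : ℕ) :
    jacobiOp s d u (k + 1) = s k * u k + s (k + 1) * u (k + 2) + d (k + 1) * u (k + 1) := by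
  simp [jacobiOp]

theorem isSelfAdjoint_jacobiOp {s d : SeqLInf} (hs : IsSelfAdjoint s) (hd : IsSelfAdjoint d) :
    IsSelfAdjoint (jacobiOp s d) := by
  rw [isSelfAdjoint_iff']
  simp only [jacobiOp, map_add, adjoint_comp, adjoint_adjoint, adjoint_diagOp, hs.star_eq,
    hd.star_eq]
  abel

/-- The first unit vector is cyclic: each application of the operator reaches one further site,
with a nonzero coefficient. -/
theorem dense_span_jacobiOp_pow {s d : SeqLInf} (hs : ∀ k, s k ≠ 0) :
    Dense (Submodule.span ℂ (Set.range fun n : ℕ => (jacobiOp s d ^ n) (seqUnit 0)) :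
      Set SeqL2) := by
  set J := jacobiOp s d
  set V := Submodule.span ℂ (Set.range fun n : ℕ => (J ^ n) (seqUnit 0))
  have hV : ∀ v ∈ V, J v ∈ V := by
    intro v hv
    have : V ≤ V.comap J.toLinearMap := by
      refine Submodule.span_le.2 ?_
      rintro _ ⟨n, rfl⟩
      refine Submodule.subset_span ⟨n + 1, ?_⟩
      simp [pow_succ']
    exact this hv
  have hJ0 : J (seqUnit 0) = d 0 • seqUnit 0 + s 0 • seqUnit 1 := by
    ext (_ | _ | k) <;> simp [J, jacobiOp_apply_zero, jacobiOp_apply_succ, seqUnit_apply]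
  have hJ : ∀ k, J (seqUnit (k + 1)) =
      s k • seqUnit k + d (k + 1) • seqUnit (k + 1) + s (k + 1) • seqUnit (k + 2) := by
    intro k
    ext (_ | j)
    · simp only [J, jacobiOp_apply_zero, seqUnit_apply, seq_add_apply, seq_smul_apply]
      rcases k with _ | k <;> simp
    · simp only [J, jacobiOp_apply_succ, seqUnit_apply, seq_add_apply, seq_smul_apply]
      by_cases h1 : j = k
      · subst h1
        simp
      by_cases h2 : j = k + 1
      · subst h2
        simp
        omega
      by_cases h3 : j + 1 = k
      · subst h3
        simp
        omega
      · have h4 : j + 2 ≠ k + 1 := by omega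
        simp [h1, h2, h3, h4]
  have hsolve : ∀ {c : ℂ} {x : SeqL2}, c ≠ 0 → c • x ∈ V → x ∈ V := fun hc h =>
    (V.smul_mem_iff hc).1 h
  have hmem : ∀ k, seqUnit k ∈ V ∧ seqUnit (k + 1) ∈ V := by
    intro k
    induction k with
    | zero =>
      have h0 : seqUnit 0 ∈ V := Submodule.subset_span ⟨0, by simp⟩
      refine ⟨h0, hsolve (hs 0) ?_⟩
      have := V.sub_mem (hV _ h0) (V.smul_mem (d 0) h0)
      rwa [hJ0, add_sub_cancel_left] at this
    | succ k ih =>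
      refine ⟨ih.2, hsolve (hs (k + 1)) ?_⟩
      have := V.sub_mem (hV _ ih.2)
        (V.add_mem (V.smul_mem (s k) ih.1) (V.smul_mem (d (k + 1)) ih.2))
      rwa [hJ, add_sub_cancel_left] at this
  have hbot : Vᗮ = ⊥ := by
    rw [Submodule.eq_bot_iff]
    intro u hu
    ext k
    rw [← inner_seqUnit_left]
    exact (Submodule.mem_orthogonal V u).1 hu _ (hmem k).1
  rw [← Submodule.topologicalClosure_eq_top_iff] at hbot
  exact Submodule.dense_iff_topologicalClosure_eq_top.2 hbot

/-- The difference between a Jacobi operator and the free one, `s = 1` and `d = 0`. -/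
noncomputable def jacobiPert (s d : SeqLInf) : SeqL2 →L[ℂ] SeqL2 := jacobiOp (s - 1) d

theorem jacobiOp_eq_free_add_pert (s d : SeqLInf) :
    jacobiOp s d = (shiftCLM + shiftCLM†) + jacobiPert s d := by
  ext u (_ | k)
  · simp [jacobiPert, jacobiOp_apply_zero]; ring
  · simp [jacobiPert, jacobiOp_apply_succ]; ring

theorem tendsto_sub_one {s : SeqLInf} (hs : Tendsto s atTop (𝓝 1)) :
    Tendsto (s - 1 : SeqLInf) atTop (𝓝 0) := by
  have := hs.sub_const 1
  rw [sub_self] at this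
  exact this

theorem isCompactOperator_jacobiPert {s d : SeqLInf} (hs : Tendsto s atTop (𝓝 1))
    (hd : Tendsto d atTop (𝓝 0)) : IsCompactOperator (jacobiPert s d) := by
  have h := isCompactOperator_diagOp (tendsto_sub_one hs)
  have h1 : IsCompactOperator (shiftCLM ∘L diagOp (s - 1)) := h.clm_comp shiftCLM
  have h2 : IsCompactOperator (diagOp (s - 1) ∘L shiftCLM†) := h.comp_clm (shiftCLM†)
  have h3 : IsCompactOperator (shiftCLM ∘L diagOp (s - 1) + diagOp (s - 1) ∘L shiftCLM†) :=
    h1.add h2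
  exact h3.add (isCompactOperator_diagOp hd)

/-- The interval `[-2, 2]`, parametrized as `z + z⁻¹` with `|z| = 1`, lies in the spectrum of a
Jacobi operator asymptotic to the free one: if the resolvent `R` existed, then, moving test vectors
`v` to infinity, `‖v‖` would be at most `‖R‖ ‖(S - z)(S - z⁻¹) v‖`, with `S` the shift. Truncated
plane waves `v` violate this bound. -/
theorem add_inv_mem_spectrum_jacobiOp {s d : SeqLInf} (hs : Tendsto s atTop (𝓝 1))
    (hd : Tendsto d atTop (𝓝 0)) {z : ℂ} (hz : ‖z‖ = 1) :
    z + z⁻¹ ∈ spectrum ℂ (jacobiOp s d) := by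
  have hz0 : z ≠ 0 := by rintro rfl; simp at hz
  intro hunit
  obtain ⟨R, hR⟩ := hunit.exists_left_inv
  set lam := z + z⁻¹
  set A : SeqL2 →L[ℂ] SeqL2 := algebraMap ℂ (SeqL2 →L[ℂ] SeqL2) lam - jacobiOp s d
  have hlow : ∀ u, ‖u‖ ≤ ‖R‖ * ‖A u‖ := by
    intro u
    have : R (A u) = u := congrArg (fun B : SeqL2 →L[ℂ] SeqL2 => B u) hR
    calc ‖u‖ = ‖R (A u)‖ := by rw [this]
      _ ≤ _ := R.le_opNorm _
  have hAu : ∀ u, A u = lam • u - shiftOp u - (shiftCLM†) u - jacobiPert s d u := by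
    intro u
    simp only [A, jacobiOp_eq_free_add_pert, sub_apply, add_apply,
      Algebra.algebraMap_eq_smul_one, smul_apply, one_apply_eq_self]
    simp only [LinearIsometry.coe_toContinuousLinearMap]
    abel
  -- apply the bound to `S ^ (N + 1) v` and let `N → ∞`, which removes the perturbation
  have hmain : ∀ v : SeqL2, ‖v‖ ≤ ‖R‖ * ‖lam • shiftOp v - shiftOp (shiftOp v) - v‖ := by
    intro v
    have hcomm : ∀ N (x y w : SeqL2), shiftOp^[N] (lam • x - y - w) =
        lam • shiftOp^[N] x - shiftOp^[N] y - shiftOp^[N] w := by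
      intro N x y w
      induction N with
      | zero => rfl
      | succ N ih => simp only [Function.iterate_succ_apply', ih, map_sub, map_smul]
    have hpert : Tendsto (fun N => ‖jacobiPert s d (shiftOp^[N + 1] v)‖) atTop (𝓝 0) := by
      have h0 := tendsto_diagOp_shiftOp_iterate (tendsto_sub_one hs) v
      have h1 := tendsto_diagOp_shiftOp_iterate (d := d) hd v
      rw [← tendsto_add_atTop_iff_nat 1] at h1
      have h2 := h0
      rw [← tendsto_add_atTop_iff_nat 1] at h2
      have h3 := (h2.add h0).add h1
      simp only [add_zero] at h3
      refine squeeze_zero (fun _ => norm_nonneg _) (fun N => ?_) h3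
      simp only [jacobiPert, jacobiOp, add_apply]
      refine (norm_add₃_le).trans ?_
      simp [Function.iterate_succ_apply', adjoint_shiftCLM_shiftOp]
    have hbd : ∀ N : ℕ, ‖v‖ ≤ ‖R‖ * (‖lam • shiftOp v - shiftOp (shiftOp v) - v‖ +
        ‖jacobiPert s d (shiftOp^[N + 1] v)‖) := by
      intro N
      have h := hlow (shiftOp^[N + 1] v)
      rw [norm_shiftOp_iterate] at h
      refine h.trans ?_
      gcongr
      rw [hAu]
      refine (norm_sub_le _ _).trans ?_
      gcongr
      rw [← norm_shiftOp_iterate N (lam • shiftOp v - shiftOp (shiftOp v) - v), hcomm]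
      simp only [← Function.iterate_succ_apply, Function.iterate_succ_apply' (f := shiftOp),
        adjoint_shiftCLM_shiftOp]
      rfl
    have := (((tendsto_const_nhds (x := ‖lam • shiftOp v - shiftOp (shiftOp v) - v‖)).add
      hpert).const_mul ‖R‖)
    rw [add_zero] at this
    exact ge_of_tendsto' this hbd
  -- the truncated plane wave `∑_{k < M} z ^ k e_k`
  let v : ℕ → SeqL2 := fun M => ∑ k ∈ Finset.range M, z ^ k • seqUnit k
  have hv1 : ∀ M, shiftOp (v M) - z⁻¹ • v M = z⁻¹ • (z ^ M • seqUnit M - seqUnit 0) := by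
    intro M
    induction M with
    | zero => simp [v]
    | succ M ih =>
      have : v (M + 1) = v M + z ^ M • seqUnit M := Finset.sum_range_succ _ _
      rw [this, map_add, smul_add, add_sub_add_comm, ih, map_smul, shiftOp_seqUnit]
      simp only [smul_sub, smul_smul, pow_succ]
      rw [show z⁻¹ * (z ^ M * z) = z ^ M by field_simp]
      abel
  have hv2 : ∀ M, ‖v M‖ ^ 2 = M := by
    intro M
    have h := lp.norm_sum_single (p := 2) (E := fun _ : ℕ => ℂ) (by norm_num) (fun k => z ^ k)
      (Finset.range M)
    simp only [ENNReal.toReal_ofNat, Real.rpow_ofNat, norm_pow, hz, one_pow, Finset.sum_const,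
      Finset.card_range, nsmul_eq_mul, mul_one] at h
    rw [← h]
    congr 2
    refine Finset.sum_congr rfl fun k _ => ?_
    rw [seqUnit, ← lp.single_smul, smul_eq_mul, mul_one]
  have hv3 : ∀ M, ‖v M‖ ≤ ‖R‖ * 4 := by
    intro M
    refine (hmain (v M)).trans ?_
    gcongr
    have : lam • shiftOp (v M) - shiftOp (shiftOp (v M)) - v M =
        z • (shiftOp (v M) - z⁻¹ • v M) - shiftOp (shiftOp (v M) - z⁻¹ • v M) := by
      simp only [lam, map_sub, map_smul, add_smul, smul_sub, smul_smul, mul_inv_cancel₀ hz0,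
        one_smul]
      abel
    rw [this, hv1]
    have h2 : ‖z⁻¹ • (z ^ M • seqUnit M - seqUnit 0)‖ ≤ 2 := by
      rw [norm_smul, norm_inv, hz, inv_one, one_mul]
      refine (norm_sub_le _ _).trans ?_
      rw [norm_smul, norm_pow, hz]
      norm_num
    refine (norm_sub_le _ _).trans ?_
    rw [norm_smul, hz, LinearIsometry.norm_map]
    linarith
  obtain ⟨M, hM⟩ := exists_nat_gt ((‖R‖ * 4) ^ 2)
  rw [← hv2 M] at hM
  exact absurd (pow_le_pow_left₀ (norm_nonneg _) (hv3 M) 2) (not_le.2 hM)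

/-- For `0 < |z| < 1` the free Jacobi operator `S + S⋆` minus `z + z⁻¹` is invertible, by the
factorization `(1 - z S⋆)(1 - z S) = z (z + z⁻¹ - S - S⋆)`. -/
theorem isUnit_add_inv_sub_free {z : ℂ} (hz0 : z ≠ 0) (hz : ‖z‖ < 1) :
    IsUnit (algebraMap ℂ (SeqL2 →L[ℂ] SeqL2) (z + z⁻¹) - (shiftCLM + shiftCLM†)) := by
  have hS : ‖shiftCLM‖ ≤ 1 := shiftOp.norm_toContinuousLinearMap_le
  have hlt : ∀ B : SeqL2 →L[ℂ] SeqL2, ‖B‖ ≤ 1 → IsUnit (1 - z • B) := by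
    intro B hB
    refine isUnit_one_sub_of_norm_lt_one ?_
    rw [norm_smul]
    exact lt_of_le_of_lt (mul_le_of_le_one_right (norm_nonneg z) hB) hz
  have h1 := (hlt (shiftCLM†) (by rwa [LinearIsometryEquiv.norm_map])).mul (hlt shiftCLM hS)
  have h2 : (1 - z • shiftCLM†) * (1 - z • shiftCLM) =
      z • (algebraMap ℂ (SeqL2 →L[ℂ] SeqL2) (z + z⁻¹) - (shiftCLM + shiftCLM†)) := by
    ext u (_ | k)
    · simp [Algebra.algebraMap_eq_smul_one]; field_simp; ring
    · simp [Algebra.algebraMap_eq_smul_one]; field_simp; ring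
  rw [h2] at h1
  have h3 := h1.smul (Units.mk0 z hz0)⁻¹
  simpa [Units.smul_def, smul_smul, hz0] using h3

/-- Outside `[-2, 2]` the spectrum of a Jacobi operator asymptotic to the free one consists of
eigenvalues, by the Fredholm alternative. -/
theorem exists_eigenvector_jacobiOp {s d : SeqLInf} (hs : Tendsto s atTop (𝓝 1))
    (hd : Tendsto d atTop (𝓝 0)) {z : ℂ} (hz0 : z ≠ 0) (hz : ‖z‖ < 1)
    (hmem : z + z⁻¹ ∈ spectrum ℂ (jacobiOp s d)) :
    ∃ u : SeqL2, u ≠ 0 ∧ jacobiOp s d u = (z + z⁻¹) • u := by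
  obtain ⟨A, hA⟩ := isUnit_add_inv_sub_free hz0 hz
  set B : SeqL2 →L[ℂ] SeqL2 := ((A⁻¹ : (SeqL2 →L[ℂ] SeqL2)ˣ) : SeqL2 →L[ℂ] SeqL2)
  have hcomp : IsCompactOperator (B * jacobiPert s d) :=
    (isCompactOperator_jacobiPert hs hd).clm_comp B
  have hdec : algebraMap ℂ (SeqL2 →L[ℂ] SeqL2) (z + z⁻¹) - jacobiOp s d =
      A * (1 - B * jacobiPert s d) := by
    rw [mul_sub, ← mul_assoc, Units.mul_inv, one_mul, mul_one, hA, jacobiOp_eq_free_add_pert]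
    abel
  rcases hcomp.hasEigenvalue_or_mem_resolventSet (one_ne_zero (α := ℂ)) with h | h
  · obtain ⟨u, hu⟩ := h.exists_hasEigenvector
    refine ⟨u, hu.2, ?_⟩
    have hu1 : B (jacobiPert s d u) = u := by simpa using hu.apply_eq_smul
    have h0 : (algebraMap ℂ (SeqL2 →L[ℂ] SeqL2) (z + z⁻¹) - jacobiOp s d) u = 0 := by
      rw [hdec]
      simp [hu1]
    rw [sub_apply, sub_eq_zero] at h0
    rw [← h0]
    simp [Algebra.algebraMap_eq_smul_one]
  · refine absurd ?_ hmem
    rw [spectrum.mem_resolventSet_iff, map_one] at h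
    rw [spectrum.mem_resolventSet_iff, hdec]
    exact A.isUnit.mul h

theorem mem_spectrum_of_eigenvector {H : Type*} [NormedAddCommGroup H] [InnerProductSpace ℂ H]
    {T : H →L[ℂ] H} {lam : ℂ} {u : H} (hu : u ≠ 0) (h : T u = lam • u) :
    lam ∈ spectrum ℂ T := by
  intro hunit
  obtain ⟨R, hR⟩ := hunit.exists_left_inv
  refine hu ?_
  have h1 : (algebraMap ℂ (H →L[ℂ] H) lam - T) u = 0 := by
    simp [Algebra.algebraMap_eq_smul_one, h]
  simpa [h1] using (congrArg (fun B : H →L[ℂ] H => B u) hR).symm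

/-! ### Bounds for `q`-shifted factorials -/

theorem one_sub_mul_pow_pos {q x : ℝ} (hq0 : 0 < q) (hq1 : q < 1) (hx : x < 1) (j : ℕ) :
    0 < 1 - x * q ^ j := by
  have h1 : 0 < q ^ j := by positivity
  have h2 : q ^ j ≤ 1 := pow_le_one₀ hq0.le hq1.le
  rcases le_or_gt x 0 with h | h <;> nlinarith

theorem qShiftedFactorial_pos {q x : ℝ} (hq0 : 0 < q) (hq1 : q < 1) (hx : x < 1) (n : ℕ) :
    0 < qShiftedFactorial x q n :=
  Finset.prod_pos fun j _ => one_sub_mul_pow_pos hq0 hq1 hx j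

theorem qShiftedFactorial_succ (x q : ℝ) (n : ℕ) :
    qShiftedFactorial x q (n + 1) = qShiftedFactorial x q n * (1 - x * q ^ n) :=
  Finset.prod_range_succ _ _

/-- For `x < 1` the finite products `(x; q)_n` are bounded away from zero and infinity, because
`|log (1 - x q ^ j)|` is at most a constant times `q ^ j`. -/
theorem exists_bounds_qShiftedFactorial {q x : ℝ} (hq0 : 0 < q) (hq1 : q < 1) (hx : x < 1) :
    ∃ B : ℝ, 0 < B ∧ ∀ n, B⁻¹ ≤ qShiftedFactorial x q n ∧ qShiftedFactorial x q n ≤ B := by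
  set δ := min 1 (1 - x)
  have hδ : 0 < δ := lt_min one_pos (by linarith)
  have hδ1 : δ ≤ 1 := min_le_left _ _
  set K := |x| / δ
  have hK : 0 ≤ K := by positivity
  have hfac : ∀ j : ℕ, 1 - x * q ^ j ≤ Real.exp (K * q ^ j) ∧
      Real.exp (-(K * q ^ j)) ≤ 1 - x * q ^ j := by
    intro j
    have hqj : 0 < q ^ j := by positivity
    have hqj1 : q ^ j ≤ 1 := pow_le_one₀ hq0.le hq1.le
    have hc : δ ≤ 1 - x * q ^ j := by
      rcases le_or_gt x 0 with h | h
      · have := mul_nonpos_of_nonpos_of_nonneg h hqj.le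
        linarith
      · have : x * q ^ j ≤ x := mul_le_of_le_one_right h.le hqj1
        linarith [min_le_right 1 (1 - x)]
    have hc0 : 0 < 1 - x * q ^ j := hδ.trans_le hc
    have habs : |x * q ^ j| = |x| * q ^ j := by rw [abs_mul, abs_of_pos hqj]
    have hxK : |x| ≤ K := by
      rw [le_div_iff₀ hδ]
      exact mul_le_of_le_one_right (abs_nonneg x) hδ1
    constructor
    · have h1 : 1 - x * q ^ j ≤ K * q ^ j + 1 := by
        have h2 := neg_abs_le (x * q ^ j)
        have h3 := mul_le_mul_of_nonneg_right hxK hqj.le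
        linarith
      exact h1.trans (Real.add_one_le_exp _)
    · have h1 : (1 - x * q ^ j)⁻¹ ≤ K * q ^ j + 1 := by
        have h2 : (1 - x * q ^ j)⁻¹ = 1 + x * q ^ j / (1 - x * q ^ j) := by
          field_simp
          ring
        have h3 : x * q ^ j / (1 - x * q ^ j) ≤ |x| * q ^ j / δ := by
          rw [← habs]
          exact div_le_div₀ (abs_nonneg _) (le_abs_self _) hδ hc
        rw [h2, show K * q ^ j = |x| * q ^ j / δ by simp only [K]; ring]
        linarith
      rw [Real.exp_neg]
      exact inv_le_of_inv_le₀ hc0 (h1.trans (Real.add_one_le_exp _))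
  have hprod : ∀ n, qShiftedFactorial x q n ≤ Real.exp (K * ∑ j ∈ Finset.range n, q ^ j) ∧
      Real.exp (-(K * ∑ j ∈ Finset.range n, q ^ j)) ≤ qShiftedFactorial x q n := by
    intro n
    rw [← neg_mul, Finset.mul_sum, Finset.mul_sum, Real.exp_sum, Real.exp_sum]
    refine ⟨Finset.prod_le_prod (fun j _ => (one_sub_mul_pow_pos hq0 hq1 hx j).le)
      fun j _ => (hfac j).1, Finset.prod_le_prod (fun j _ => (Real.exp_pos _).le) fun j _ => ?_⟩
    rw [neg_mul]
    exact (hfac j).2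
  have hsum : ∀ n : ℕ, ∑ j ∈ Finset.range n, q ^ j ≤ (1 - q)⁻¹ := fun n => by
    rw [← tsum_geometric_of_lt_one hq0.le hq1]
    exact (summable_geometric_of_lt_one hq0.le hq1).sum_le_tsum _ fun _ _ => by positivity
  refine ⟨Real.exp (K * (1 - q)⁻¹), Real.exp_pos _, fun n => ⟨?_, (hprod n).1.trans ?_⟩⟩
  · rw [← Real.exp_neg]
    refine le_trans ?_ (hprod n).2
    gcongr
    exact hsum n
  · gcongr
    exact hsum n

/-! ### The Al-Salam–Chihara recurrence -/

/-- The factors `ρ_n = √((q; q)_n / (p; q)_n)` relating the solution `u_n = ρ_n g_n` of the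
symmetric recurrence to the coefficients `g_n` of the generating function. -/
noncomputable def ascFactor (q p : ℝ) (n : ℕ) : ℝ :=
  √(qShiftedFactorial q q n / qShiftedFactorial p q n)

theorem ascFactor_pos {q p : ℝ} (hq0 : 0 < q) (hq1 : q < 1) (hp : p < 1) (n : ℕ) :
    0 < ascFactor q p n :=
  Real.sqrt_pos.2 (div_pos (qShiftedFactorial_pos hq0 hq1 hq1 n)
    (qShiftedFactorial_pos hq0 hq1 hp n))

theorem exists_bounds_ascFactor {q p : ℝ} (hq0 : 0 < q) (hq1 : q < 1) (hp : p < 1) :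
    ∃ B : ℝ, 0 < B ∧ ∀ n, ascFactor q p n ≤ B ∧ (ascFactor q p n)⁻¹ ≤ B := by
  obtain ⟨B, hB, h⟩ := exists_bounds_qShiftedFactorial hq0 hq1 hq1
  obtain ⟨C, hC, h'⟩ := exists_bounds_qShiftedFactorial hq0 hq1 hp
  refine ⟨√(B * C), by positivity, fun n => ?_⟩
  have hx := qShiftedFactorial_pos hq0 hq1 hq1 n
  have hy := qShiftedFactorial_pos hq0 hq1 hp n
  have hxi := inv_le_of_inv_le₀ hB (h n).1
  have hyi := inv_le_of_inv_le₀ hC (h' n).1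
  constructor
  · refine Real.sqrt_le_sqrt ?_
    rw [div_eq_mul_inv]
    gcongr
    exact (h n).2
  · rw [ascFactor, ← Real.sqrt_inv, inv_div, div_eq_mul_inv, mul_comm]
    refine Real.sqrt_le_sqrt ?_
    gcongr
    exact (h' n).2

/-- The off-diagonal entries of the Al-Salam–Chihara Jacobi matrix. -/
noncomputable def ascOffDiag (q p : ℝ) (k : ℕ) : ℝ :=
  √((1 - q ^ (k + 1)) * (1 - p * q ^ k))

theorem ascFactor_succ {q p : ℝ} (hq0 : 0 < q) (hq1 : q < 1) (hp : p < 1) (k : ℕ) :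
    ascFactor q p (k + 1) = ascFactor q p k * (√(1 - q ^ (k + 1)) / √(1 - p * q ^ k)) := by
  have h1 := one_sub_mul_pow_pos hq0 hq1 hq1 k
  rw [← pow_succ'] at h1
  rw [ascFactor, ascFactor, ← Real.sqrt_div h1.le,
    ← Real.sqrt_mul (div_pos (qShiftedFactorial_pos hq0 hq1 hq1 k)
      (qShiftedFactorial_pos hq0 hq1 hp k)).le, qShiftedFactorial_succ, qShiftedFactorial_succ,
    mul_div_mul_comm, pow_succ']

theorem ascOffDiag_mul_factor_succ {q p : ℝ} (hq0 : 0 < q) (hq1 : q < 1) (hp : p < 1) (k : ℕ) :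
    ascOffDiag q p k * ascFactor q p (k + 1) = (1 - q ^ (k + 1)) * ascFactor q p k := by
  have h1 := one_sub_mul_pow_pos hq0 hq1 hq1 k
  rw [← pow_succ'] at h1
  have h2 := one_sub_mul_pow_pos hq0 hq1 hp k
  have h3 := Real.sqrt_pos.2 h2
  rw [ascFactor_succ hq0 hq1 hp, ascOffDiag, Real.sqrt_mul h1.le]
  field_simp
  rw [Real.sq_sqrt h1.le]

theorem ascOffDiag_mul_factor {q p : ℝ} (hq0 : 0 < q) (hq1 : q < 1) (hp : p < 1) (k : ℕ) :
    ascOffDiag q p k * ascFactor q p k = (1 - p * q ^ k) * ascFactor q p (k + 1) := by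
  have h1 := one_sub_mul_pow_pos hq0 hq1 hq1 k
  rw [← pow_succ'] at h1
  have h2 := one_sub_mul_pow_pos hq0 hq1 hp k
  have h3 := Real.sqrt_pos.2 h2
  rw [ascFactor_succ hq0 hq1 hp, ascOffDiag, Real.sqrt_mul h1.le]
  field_simp
  rw [Real.sq_sqrt h2.le]

theorem ascOffDiag_pos {q p : ℝ} (hq0 : 0 < q) (hq1 : q < 1) (hp : p < 1) (k : ℕ) :
    0 < ascOffDiag q p k := by
  have h1 := one_sub_mul_pow_pos hq0 hq1 hq1 k
  rw [← pow_succ'] at h1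
  exact Real.sqrt_pos.2 (mul_pos h1 (one_sub_mul_pow_pos hq0 hq1 hp k))

theorem tendsto_ascOffDiag {q : ℝ} (p : ℝ) (hq0 : 0 < q) (hq1 : q < 1) :
    Tendsto (fun k => (ascOffDiag q p k : ℂ)) atTop (𝓝 1) := by
  have h := tendsto_pow_atTop_nhds_zero_of_lt_one hq0.le hq1
  have h1 := ((h.comp (tendsto_add_atTop_nat 1)).const_sub 1).mul ((h.const_mul p).const_sub 1)
  have h2 := (Real.continuous_sqrt.tendsto _).comp h1
  simp only [mul_zero, sub_zero, mul_one, Real.sqrt_one] at h2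
  exact_mod_cast (Complex.continuous_ofReal.tendsto 1).comp h2

theorem tendsto_ascDiag {q : ℝ} (m : ℝ) (hq0 : 0 < q) (hq1 : q < 1) :
    Tendsto (fun k : ℕ => ((m * q ^ k : ℝ) : ℂ)) atTop (𝓝 0) := by
  have h1 := (tendsto_pow_atTop_nhds_zero_of_lt_one hq0.le hq1).const_mul m
  rw [mul_zero] at h1
  exact_mod_cast (Complex.continuous_ofReal.tendsto 0).comp h1

/-- A convergent sequence as an element of `ℓ^∞`. -/
noncomputable def convSeq (u : ℕ → ℂ) {x : ℂ} (hu : Tendsto u atTop (𝓝 x)) : SeqLInf :=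
  ⟨u, memℓp_infty hu.norm.bddAbove_range⟩

@[simp]
theorem convSeq_apply (u : ℕ → ℂ) {x : ℂ} (hu : Tendsto u atTop (𝓝 x)) (k : ℕ) :
    convSeq u hu k = u k := rfl

/-- The Al-Salam–Chihara Jacobi operator, with diagonal `m q ^ k` and off-diagonal entries
`√((1 - q ^ (k + 1)) (1 - p q ^ k))`. In terms of the usual parameters, `m = α + β` and
`p = α β`. -/
noncomputable def ascOp {q : ℝ} (hq0 : 0 < q) (hq1 : q < 1) (p m : ℝ) : SeqL2 →L[ℂ] SeqL2 :=
  jacobiOp (convSeq _ (tendsto_ascOffDiag p hq0 hq1)) (convSeq _ (tendsto_ascDiag m hq0 hq1))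

/-- The recurrence of the coefficients `g` of a power series `G` with
`(1 - lam t + e t²) G(t) = (1 - m t + p t²) G(q t)`. -/
def GenRec (q p m : ℝ) (lam e : ℂ) (g : ℕ → ℂ) : Prop :=
  (1 - q) * g 1 + m * g 0 = lam * g 0 ∧
    ∀ k : ℕ, (1 - (q : ℂ) ^ (k + 2)) * g (k + 2) + (e - p * (q : ℂ) ^ k) * g k
      + m * (q : ℂ) ^ (k + 1) * g (k + 1) = lam * g (k + 1)

/-- The substitution `u_n = ρ_n g_n` turns the eigenvalue equation into the recurrence for the
coefficients of the generating function. -/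
theorem ascOp_apply_eq_iff {q p m : ℝ} (hq0 : 0 < q) (hq1 : q < 1) (hp : p < 1) {lam : ℂ}
    {u : SeqL2} {g : ℕ → ℂ} (hug : ∀ n, u n = ascFactor q p n * g n) :
    ascOp hq0 hq1 p m u = lam • u ↔ GenRec q p m lam 1 g := by
  have hρ : ∀ n, (ascFactor q p n : ℂ) ≠ 0 := fun n =>
    Complex.ofReal_ne_zero.2 (ascFactor_pos hq0 hq1 hp n).ne'
  have hs1 : ∀ k, (ascOffDiag q p k : ℂ) * ascFactor q p (k + 1) =
      (1 - (q : ℂ) ^ (k + 1)) * ascFactor q p k := fun k => by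
    exact_mod_cast ascOffDiag_mul_factor_succ hq0 hq1 hp k
  have hs2 : ∀ k, (ascOffDiag q p k : ℂ) * ascFactor q p k =
      (1 - p * (q : ℂ) ^ k) * ascFactor q p (k + 1) := fun k => by
    exact_mod_cast ascOffDiag_mul_factor hq0 hq1 hp k
  have h0 : ascOp hq0 hq1 p m u 0 = (lam • u) 0 ↔ (1 - q) * g 1 + m * g 0 = lam * g 0 := by
    rw [ascOp, jacobiOp_apply_zero, seq_smul_apply, hug, hug]
    refine Iff.trans ?_ (mul_right_inj' (hρ 0))
    simp only [convSeq_apply]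
    have := hs1 0
    simp only [zero_add, pow_one] at this
    rw [← mul_assoc, this]
    push_cast
    ring_nf
  have hk : ∀ k, ascOp hq0 hq1 p m u (k + 1) = (lam • u) (k + 1) ↔
      (1 - (q : ℂ) ^ (k + 2)) * g (k + 2) + (1 - p * (q : ℂ) ^ k) * g k
        + m * (q : ℂ) ^ (k + 1) * g (k + 1) = lam * g (k + 1) := by
    intro k
    rw [ascOp, jacobiOp_apply_succ, seq_smul_apply, hug, hug, hug]
    refine Iff.trans ?_ (mul_right_inj' (hρ (k + 1)))
    simp only [convSeq_apply]
    rw [← mul_assoc, hs2, ← mul_assoc, hs1 (k + 1)]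
    push_cast
    ring_nf
  constructor
  · intro h
    exact ⟨h0.1 (by rw [h]), fun k => (hk k).1 (by rw [h])⟩
  · rintro ⟨h1, h2⟩
    ext (_ | k)
    · exact h0.2 h1
    · exact (hk k).2 (h2 k)

/-! ### The generating function of an eigenvector -/

/-- A solution of the recurrence is determined by its initial value, as the leading coefficients
`1 - q ^ (k + 1)` do not vanish. -/
theorem GenRec.eq_zero {q p m : ℝ} (hq0 : 0 < q) (hq1 : q < 1) {lam e : ℂ} {g : ℕ → ℂ}
    (h : GenRec q p m lam e g) (hg : g 0 = 0) (n : ℕ) : g n = 0 := by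
  have hne : ∀ k : ℕ, (1 : ℂ) - (q : ℂ) ^ (k + 1) ≠ 0 := by
    intro k
    have : q ^ (k + 1) < 1 := pow_lt_one₀ hq0.le hq1 (by omega)
    exact_mod_cast (sub_pos.2 this).ne'
  have hg1 : g 1 = 0 := by
    have := h.1
    rw [hg, mul_zero, mul_zero, add_zero] at this
    exact (mul_eq_zero.1 this).resolve_left (by simpa using hne 0)
  have : ∀ k, g k = 0 ∧ g (k + 1) = 0 := by
    intro k
    induction k with
    | zero => exact ⟨hg, hg1⟩
    | succ k ih =>
      refine ⟨ih.2, ?_⟩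
      have := h.2 k
      rw [ih.1, ih.2, mul_zero, mul_zero, mul_zero, add_zero, add_zero] at this
      exact (mul_eq_zero.1 this).resolve_left (hne (k + 1))
  exact (this n).1

theorem summable_mul_pow_of_bounded {g : ℕ → ℂ} {C : ℝ} (hC : ∀ n, ‖g n‖ ≤ C) {t : ℂ}
    (ht : ‖t‖ < 1) : Summable fun n => g n * t ^ n := by
  refine Summable.of_norm_bounded ((summable_geometric_of_lt_one (norm_nonneg t) ht).mul_left C)
    fun n => ?_
  rw [norm_mul, norm_pow]
  gcongr
  exact hC n

/-- The `q`-difference equation of the generating function. -/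
theorem GenRec.tsum_eq {q p m : ℝ} (hq0 : 0 < q) (hq1 : q < 1) {lam e : ℂ} {g : ℕ → ℂ}
    (h : GenRec q p m lam e g) {C : ℝ} (hC : ∀ n, ‖g n‖ ≤ C) {t : ℂ} (ht : ‖t‖ < 1) :
    (1 - lam * t + e * t ^ 2) * ∑' n, g n * t ^ n =
      (1 - m * t + p * t ^ 2) * ∑' n, g n * (q * t) ^ n := by
  have hqt : ‖(q : ℂ) * t‖ < 1 := by
    rw [norm_mul, Complex.norm_real, Real.norm_of_nonneg hq0.le]
    exact (mul_le_of_le_one_left (norm_nonneg t) hq1.le).trans_lt ht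
  have hs := summable_mul_pow_of_bounded hC ht
  have hsq := summable_mul_pow_of_bounded hC hqt
  have hsplit : ∀ x : ℂ, (Summable fun n => g n * x ^ n) →
      ∑' n, g n * x ^ n = g 0 + ∑' n, g (n + 1) * x ^ (n + 1) ∧
      ∑' n, g n * x ^ n = g 0 + g 1 * x + ∑' n, g (n + 2) * x ^ (n + 2) := by
    intro x hx
    have h1 := hx.tsum_eq_zero_add
    have h2 := ((summable_nat_add_iff 1).2 hx).tsum_eq_zero_add
    simp only [pow_zero, mul_one, zero_add, pow_one] at h1 h2
    refine ⟨h1, ?_⟩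
    rw [h1, h2, add_assoc]
  -- the coefficient of `t ^ (n + 2)` on both sides
  have hcoef : ∀ n, (g (n + 2) * t ^ (n + 2) - lam * t * (g (n + 1) * t ^ (n + 1)) +
      e * t ^ 2 * (g n * t ^ n)) = (g (n + 2) * (q * t) ^ (n + 2) -
      m * t * (g (n + 1) * (q * t) ^ (n + 1)) + p * t ^ 2 * (g n * (q * t) ^ n)) := by
    intro n
    have := h.2 n
    simp only [mul_pow]
    linear_combination t ^ (n + 2) * this
  have hsum : ∀ x A B : ℂ, (Summable fun n => g n * x ^ n) →
      ∑' n, (g (n + 2) * x ^ (n + 2) - A * (g (n + 1) * x ^ (n + 1)) + B * (g n * x ^ n)) =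
      ∑' n, g (n + 2) * x ^ (n + 2) - A * ∑' n, g (n + 1) * x ^ (n + 1)
        + B * ∑' n, g n * x ^ n := by
    intro x A B hx
    have h1 := (summable_nat_add_iff 1).2 hx
    have h2 := (summable_nat_add_iff 2).2 hx
    rw [(h2.sub (h1.mul_left A)).tsum_add (hx.mul_left B), h2.tsum_sub (h1.mul_left A),
      tsum_mul_left, tsum_mul_left]
  have hmain := (hsum t (lam * t) (e * t ^ 2) hs).symm.trans
    ((tsum_congr hcoef).trans (hsum (q * t) (m * t) (p * t ^ 2) hsq))
  obtain ⟨h1, h2⟩ := hsplit t hs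
  obtain ⟨h3, h4⟩ := hsplit _ hsq
  have h0 := h.1
  linear_combination hmain + h2 - lam * t * h1 - h4 + m * t * h3 + t * h0

/-- An eigenvalue `z + z⁻¹` with `|z| < 1` forces `α z q ^ k = 1` or `β z q ^ k = 1` for some `k`:
the generating function `G` satisfies `(1 - z t)(1 - t / z) G(t) = (1 - α t)(1 - β t) G(q t)`, whose
left side vanishes at `t = z`; otherwise `G` would vanish at all `z q ^ n`, `n ≥ 1`, hence at `0`. -/
theorem exists_mul_pow_eq_one_of_eigenvector {q p m : ℝ} (hq0 : 0 < q) (hq1 : q < 1) (hp : p < 1)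
    {α β z : ℂ} (hm : α + β = m) (hαβ : α * β = p) (hz0 : z ≠ 0) (hz : ‖z‖ < 1) {u : SeqL2}
    (hu : u ≠ 0) (h : ascOp hq0 hq1 p m u = (z + z⁻¹) • u) :
    ∃ k : ℕ, α * z * (q : ℂ) ^ k = 1 ∨ β * z * (q : ℂ) ^ k = 1 := by
  by_contra! hne
  obtain ⟨B, hB, hbd⟩ := exists_bounds_ascFactor hq0 hq1 hp
  have hρ : ∀ n, (ascFactor q p n : ℂ) ≠ 0 := fun n =>
    Complex.ofReal_ne_zero.2 (ascFactor_pos hq0 hq1 hp n).ne'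
  set g : ℕ → ℂ := fun n => (ascFactor q p n : ℂ)⁻¹ * u n
  have hug : ∀ n, u n = ascFactor q p n * g n := fun n => by
    simp only [g, mul_inv_cancel_left₀ (hρ n)]
  have hrec := (ascOp_apply_eq_iff hq0 hq1 hp hug).1 h
  have hC : ∀ n, ‖g n‖ ≤ B * ‖u‖ := by
    intro n
    have h1 := (hbd n).2
    have h2 := lp.norm_apply_le_norm (by simp) u n
    simp only [g, norm_mul, norm_inv, Complex.norm_real,
      Real.norm_of_nonneg (ascFactor_pos hq0 hq1 hp n).le]
    gcongr
  set G : ℂ → ℂ := fun t => ∑' n, g n * t ^ n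
  have hG : ∀ t : ℂ, ‖t‖ < 1 →
      (1 - z * t) * (1 - z⁻¹ * t) * G t = (1 - α * t) * (1 - β * t) * G (q * t) := by
    intro t ht
    have := hrec.tsum_eq hq0 hq1 hC ht
    rw [← hm, ← hαβ] at this
    linear_combination this + t ^ 2 * G t * mul_inv_cancel₀ hz0
  have hzn : ∀ n : ℕ, ‖z * (q : ℂ) ^ n‖ ≤ ‖z‖ := by
    intro n
    rw [norm_mul, norm_pow, Complex.norm_real, Real.norm_of_nonneg hq0.le]
    exact mul_le_of_le_one_right (norm_nonneg z) (pow_le_one₀ hq0.le hq1.le)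
  have hzero : ∀ n : ℕ, G (z * (q : ℂ) ^ (n + 1)) = 0 := by
    intro n
    have key : ∀ n : ℕ, (1 - z⁻¹ * (z * (q : ℂ) ^ n)) * G (z * (q : ℂ) ^ n) = 0 →
        G (z * (q : ℂ) ^ (n + 1)) = 0 := by
      intro n h0
      have h1 := hG _ ((hzn n).trans_lt hz)
      rw [mul_assoc, h0, mul_zero] at h1
      have h2 : (1 - α * (z * (q : ℂ) ^ n)) * (1 - β * (z * (q : ℂ) ^ n)) ≠ 0 := by
        refine mul_ne_zero (sub_ne_zero.2 ?_) (sub_ne_zero.2 ?_)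
        · rw [← mul_assoc]; exact (hne n).1.symm
        · rw [← mul_assoc]; exact (hne n).2.symm
      have h3 := (mul_eq_zero.1 h1.symm).resolve_left h2
      rw [pow_succ']
      rwa [mul_left_comm] at h3
    induction n with
    | zero => exact key 0 (by simp [hz0])
    | succ n ih => exact key (n + 1) (by rw [ih, mul_zero])
  have hlim : Tendsto (fun n : ℕ => G (z * (q : ℂ) ^ (n + 1))) atTop (𝓝 (g 0)) := by
    have hz' : Summable fun k : ℕ => B * ‖u‖ * ‖z‖ ^ k :=
      (summable_geometric_of_lt_one (norm_nonneg z) hz).mul_left _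
    have hqt : Tendsto (fun n : ℕ => z * (q : ℂ) ^ (n + 1)) atTop (𝓝 0) := by
      have h1 : ‖(q : ℂ)‖ < 1 := by rwa [Complex.norm_real, Real.norm_of_nonneg hq0.le]
      have h2 := ((tendsto_pow_atTop_nhds_zero_of_norm_lt_one h1).comp
        (tendsto_add_atTop_nat 1)).const_mul z
      rwa [mul_zero] at h2
    have hG0 : ∑' k, g k * (0 : ℂ) ^ k = g 0 := by
      rw [tsum_eq_single 0 (by intro k hk; simp [hk])]
      simp
    rw [← hG0]
    refine tendsto_tsum_of_dominated_convergence hz' (fun k => (hqt.pow k).const_mul (g k))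
      (Eventually.of_forall fun n k => ?_)
    rw [norm_mul, norm_pow]
    gcongr
    · exact hC k
    · exact hzn (n + 1)
  simp only [hzero] at hlim
  have hg0 : g 0 = 0 := tendsto_nhds_unique hlim tendsto_const_nhds
  refine hu ?_
  ext n
  rw [hug, hrec.eq_zero hq0 hq1 hg0, mul_zero]
  rfl

/-! ### Eigenvectors from terminating generating functions -/

open PowerSeries in
theorem genRec_of_powerSeries {q p m : ℝ} {α β z a : ℂ} (hm : α + β = m) (hαβ : α * β = p)
    {g : ℕ → ℂ} (h : (1 - C z * X) * (1 - C a * X) * PowerSeries.mk g =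
      (1 - C α * X) * (1 - C β * X) * rescale (q : ℂ) (PowerSeries.mk g)) :
    GenRec q p m (z + a) (z * a) g := by
  have hexp : ∀ (x y : ℂ) (f : PowerSeries ℂ), (1 - C x * X) * (1 - C y * X) * f =
      f - (x + y) • (X * f) + (x * y) • (X * (X * f)) := by
    intro x y f
    rw [PowerSeries.smul_eq_C_mul, PowerSeries.smul_eq_C_mul, map_add, map_mul]
    ring
  have h0 : ∀ f : PowerSeries ℂ, coeff 0 (X * f) = 0 := fun f => coeff_zero_X_mul f
  have h1 : ∀ f : PowerSeries ℂ, coeff 1 (X * f) = coeff 0 f := fun f => coeff_succ_X_mul 0 f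
  have h2 : ∀ k (f : PowerSeries ℂ), coeff (k + 2) (X * f) = coeff (k + 1) f :=
    fun k f => coeff_succ_X_mul (k + 1) f
  rw [hexp, hexp] at h
  constructor
  · have h3 := congrArg (coeff 1) h
    simp only [map_add, map_sub, map_smul, h0, h1, coeff_mk, coeff_rescale, smul_eq_mul] at h3
    rw [← hm]
    linear_combination h3
  · intro k
    have h3 := congrArg (coeff (k + 2)) h
    simp only [map_add, map_sub, map_smul, h2, coeff_succ_X_mul, coeff_mk, coeff_rescale,
      smul_eq_mul] at h3
    rw [← hm, ← hαβ]
    linear_combination h3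

/-- The coefficients `∏_{j < n} (z - β q ^ j) / (1 - q ^ (j + 1))` of `(β t; q)_∞ / (z t; q)_∞`. -/
noncomputable def binomCoeff (q : ℝ) (β z : ℂ) (n : ℕ) : ℂ :=
  ∏ j ∈ Finset.range n, (z - β * (q : ℂ) ^ j) / (1 - (q : ℂ) ^ (j + 1))

theorem binomCoeff_succ (q : ℝ) (β z : ℂ) (n : ℕ) : binomCoeff q β z (n + 1) =
    binomCoeff q β z n * ((z - β * (q : ℂ) ^ n) / (1 - (q : ℂ) ^ (n + 1))) :=
  Finset.prod_range_succ _ _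

theorem summable_binomCoeff {q : ℝ} (hq0 : 0 < q) (hq1 : q < 1) (β : ℂ) {z : ℂ} (hz : ‖z‖ < 1) :
    Summable fun n => ‖binomCoeff q β z n‖ ^ 2 := by
  have h1 : ‖(q : ℂ)‖ < 1 := by rwa [Complex.norm_real, Real.norm_of_nonneg hq0.le]
  have h2 := tendsto_pow_atTop_nhds_zero_of_norm_lt_one h1
  have h3 := ((h2.const_mul β).const_sub z).div ((h2.comp (tendsto_add_atTop_nat 1)).const_sub 1)
    (by simp)
  have h4 := h3.norm.pow 2
  simp only [mul_zero, sub_zero, div_one] at h4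
  have h5 : ‖z‖ ^ 2 < 1 := pow_lt_one₀ (norm_nonneg z) hz two_ne_zero
  obtain ⟨r, hr, hr1⟩ := exists_between h5
  refine summable_of_ratio_norm_eventually_le hr1 ?_
  filter_upwards [h4.eventually_le_const hr] with n hn
  rw [binomCoeff_succ, norm_mul, mul_pow, norm_mul, mul_comm]
  refine mul_le_mul_of_nonneg_right ?_ (norm_nonneg _)
  rw [Real.norm_of_nonneg (by positivity)]
  exact hn

open PowerSeries in
theorem powerSeries_mk_sub_smul_shiftOp (a : ℂ) (v : SeqL2) :
    PowerSeries.mk (v - a • shiftOp v : SeqL2) = (1 - C a * X) * PowerSeries.mk v := by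
  ext (_ | n)
  · rw [sub_mul, one_mul, mul_assoc, map_sub, coeff_C_mul, coeff_zero_X_mul,
      coeff_mk, coeff_mk, seq_sub_apply]
    simp
  · rw [sub_mul, one_mul, mul_assoc, map_sub, coeff_C_mul, coeff_succ_X_mul,
      coeff_mk, coeff_mk, coeff_mk, seq_sub_apply]
    simp

open PowerSeries in
/-- The coefficients of `(α t; q)_j (β t; q)_∞ / (z t; q)_∞` are square-summable, and this series
solves `(1 - z t)(1 - α q ^ j t) G(t) = (1 - α t)(1 - β t) G(q t)`. -/
theorem exists_seq_powerSeries {q : ℝ} (hq0 : 0 < q) (hq1 : q < 1) (α β : ℂ) {z : ℂ}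
    (hz : ‖z‖ < 1) (j : ℕ) :
    ∃ v : SeqL2, v 0 = 1 ∧ (1 - C z * X) * (1 - C (α * (q : ℂ) ^ j) * X) * PowerSeries.mk v =
      (1 - C α * X) * (1 - C β * X) * rescale (q : ℂ) (PowerSeries.mk v) := by
  induction j with
  | zero =>
    refine ⟨mkSeq _ (summable_binomCoeff hq0 hq1 β hz), by simp [binomCoeff], ?_⟩
    have hbase : (1 - C z * X) * PowerSeries.mk (binomCoeff q β z) =
        (1 - C β * X) * rescale (q : ℂ) (PowerSeries.mk (binomCoeff q β z)) := by
      ext (_ | n)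
      · simp only [sub_mul, one_mul, mul_assoc, map_sub, coeff_C_mul, coeff_zero_X_mul,
          coeff_rescale, pow_zero, mul_zero]
      · rw [sub_mul, one_mul, mul_assoc, sub_mul, one_mul, mul_assoc, map_sub, map_sub,
          coeff_C_mul, coeff_succ_X_mul, coeff_C_mul, coeff_succ_X_mul, coeff_rescale,
          coeff_rescale, coeff_mk, coeff_mk, binomCoeff_succ]
        have hne : (1 : ℂ) - (q : ℂ) ^ (n + 1) ≠ 0 := by
          have : q ^ (n + 1) < 1 := pow_lt_one₀ hq0.le hq1 (by omega)
          exact_mod_cast (sub_pos.2 this).ne'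
        field_simp
        ring
    rw [pow_zero, mul_one]
    change (1 - C z * X) * (1 - C α * X) * PowerSeries.mk (binomCoeff q β z) = (1 - C α * X) *
      (1 - C β * X) * rescale (q : ℂ) (PowerSeries.mk (binomCoeff q β z))
    linear_combination (1 - C α * X) * hbase
  | succ j ih =>
    obtain ⟨v, hv0, hv⟩ := ih
    refine ⟨v - (α * (q : ℂ) ^ j) • shiftOp v, by simp [hv0], ?_⟩
    have hr : rescale (q : ℂ) (1 - C (α * (q : ℂ) ^ j) * X) =
        1 - C (α * (q : ℂ) ^ (j + 1)) * X := by
      ext (_ | n)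
      · simp
      · rw [coeff_rescale, map_sub, map_sub, coeff_C_mul, coeff_C_mul, coeff_X, coeff_one]
        rcases n with _ | n
        · simp
          ring
        · simp
    rw [powerSeries_mk_sub_smul_shiftOp, map_mul (rescale (q : ℂ)), hr]
    linear_combination (1 - C (α * (q : ℂ) ^ (j + 1)) * X) * hv

/-- If `α z q ^ k = 1`, then `z⁻¹ = α q ^ k`, and the series of `exists_seq_powerSeries` with `j = k`
solves the equation of the generating function for the spectral value `z + z⁻¹`. -/
theorem exists_eigenvector_ascOp {q p m : ℝ} (hq0 : 0 < q) (hq1 : q < 1) (hp : p < 1)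
    {α β z : ℂ} (hm : α + β = m) (hαβ : α * β = p) (hz : ‖z‖ < 1) {k : ℕ}
    (hk : α * z * (q : ℂ) ^ k = 1) :
    ∃ u : SeqL2, u ≠ 0 ∧ ascOp hq0 hq1 p m u = (z + z⁻¹) • u := by
  have hz0 : z ≠ 0 := by rintro rfl; simp at hk
  obtain ⟨v, hv0, hv⟩ := exists_seq_powerSeries hq0 hq1 α β hz k
  have ha : α * (q : ℂ) ^ k = z⁻¹ := by
    refine eq_inv_of_mul_eq_one_left ?_
    linear_combination hk
  rw [ha] at hv
  have hrec := genRec_of_powerSeries hm hαβ hv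
  rw [mul_inv_cancel₀ hz0] at hrec
  obtain ⟨B, hB, hbd⟩ := exists_bounds_ascFactor hq0 hq1 hp
  refine ⟨mkSeq (fun n => ascFactor q p n * v n) ?_, ?_, ?_⟩
  · refine Summable.of_nonneg_of_le (fun _ => by positivity) (fun n => ?_)
      ((summable_norm_sq v).mul_left (B ^ 2))
    rw [norm_mul, mul_pow, Complex.norm_real,
      Real.norm_of_nonneg (ascFactor_pos hq0 hq1 hp n).le]
    have h1 := (hbd n).1
    have h2 := (ascFactor_pos hq0 hq1 hp n).le
    gcongr
  · intro h0
    have h1 := congrArg (fun w : SeqL2 => w 0) h0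
    simp only [mkSeq_apply, hv0, mul_one, seq_zero_apply] at h1
    exact (ascFactor_pos hq0 hq1 hp 0).ne' (Complex.ofReal_eq_zero.1 h1)
  · exact (ascOp_apply_eq_iff hq0 hq1 hp fun n => mkSeq_apply _ _ n).2 hrec

/-! ### The spectrum of the Al-Salam–Chihara operator -/

theorem isSelfAdjoint_convSeq_ofReal {f : ℕ → ℝ} {x : ℂ}
    (h : Tendsto (fun k => (f k : ℂ)) atTop (𝓝 x)) : IsSelfAdjoint (convSeq _ h) := by
  rw [isSelfAdjoint_iff]
  ext k
  rw [lp.star_apply, convSeq_apply]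
  exact Complex.conj_ofReal _

theorem isSelfAdjoint_ascOp {q : ℝ} (hq0 : 0 < q) (hq1 : q < 1) (p m : ℝ) :
    IsSelfAdjoint (ascOp hq0 hq1 p m) :=
  isSelfAdjoint_jacobiOp (isSelfAdjoint_convSeq_ofReal _) (isSelfAdjoint_convSeq_ofReal _)

/-- Every complex number has the form `z + z⁻¹` with `0 < |z| ≤ 1`: the roots of
`z² - lam z + 1` have product one. -/
theorem exists_add_inv_eq (lam : ℂ) : ∃ z : ℂ, z ≠ 0 ∧ ‖z‖ ≤ 1 ∧ lam = z + z⁻¹ := by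
  obtain ⟨s, hs⟩ := IsAlgClosed.exists_pow_nat_eq (lam ^ 2 - 4) (n := 2) two_pos
  set w := (lam + s) / 2
  set w' := (lam - s) / 2
  have hprod : w * w' = 1 := by
    simp only [w, w']
    linear_combination -hs / 4
  have hsum : lam = w + w' := by
    simp only [w, w']
    ring
  have hw : w ≠ 0 := left_ne_zero_of_mul_eq_one hprod
  have hw' : w' ≠ 0 := right_ne_zero_of_mul_eq_one hprod
  rcases le_total ‖w‖ 1 with h | h
  · exact ⟨w, hw, h, by rw [← eq_inv_of_mul_eq_one_right hprod]; exact hsum⟩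
  · refine ⟨w', hw', ?_, by rw [← eq_inv_of_mul_eq_one_left hprod, add_comm]; exact hsum⟩
    rw [eq_inv_of_mul_eq_one_right hprod, norm_inv]
    exact inv_le_one_of_one_le₀ h

/-- The spectrum of the Al-Salam–Chihara operator in the uniformizing variable `z`: the unit circle
together with the points `z` inside it where `(α z, β z; q)_∞` vanishes. -/
theorem mem_spectrum_ascOp_iff {q p m : ℝ} (hq0 : 0 < q) (hq1 : q < 1) (hp : p < 1)
    {α β : ℂ} (hm : α + β = m) (hαβ : α * β = p) (lam : ℂ) :
    lam ∈ spectrum ℂ (ascOp hq0 hq1 p m) ↔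
      (∃ z : ℂ, ‖z‖ = 1 ∧ lam = z + z⁻¹) ∨
      ∃ z : ℂ, ‖z‖ < 1 ∧ lam = z + z⁻¹ ∧
        ∃ k : ℕ, α * z * (q : ℂ) ^ k = 1 ∨ β * z * (q : ℂ) ^ k = 1 := by
  constructor
  · intro h
    obtain ⟨z, hz0, hz1, rfl⟩ := exists_add_inv_eq lam
    rcases hz1.eq_or_lt with h1 | h1
    · exact Or.inl ⟨z, h1, rfl⟩
    · obtain ⟨u, hu, hu'⟩ := exists_eigenvector_jacobiOp (tendsto_ascOffDiag p hq0 hq1)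
        (tendsto_ascDiag m hq0 hq1) hz0 h1 h
      exact Or.inr ⟨z, h1, rfl,
        exists_mul_pow_eq_one_of_eigenvector hq0 hq1 hp hm hαβ hz0 h1 hu hu'⟩
  · rintro (⟨z, hz, rfl⟩ | ⟨z, hz, rfl, k, hk | hk⟩)
    · exact add_inv_mem_spectrum_jacobiOp (tendsto_ascOffDiag p hq0 hq1)
        (tendsto_ascDiag m hq0 hq1) hz
    · obtain ⟨u, hu, hu'⟩ := exists_eigenvector_ascOp hq0 hq1 hp hm hαβ hz hk
      exact mem_spectrum_of_eigenvector hu hu'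
    · rw [add_comm] at hm
      rw [mul_comm] at hαβ
      obtain ⟨u, hu, hu'⟩ := exists_eigenvector_ascOp hq0 hq1 hp hm hαβ hz hk
      exact mem_spectrum_of_eigenvector hu hu'

/-! ### The Hilbert space of the little `q`-Jacobi measure -/

section Weight

variable {q a b : ℝ}

theorem littleQJacobiWeight_pos (hq0 : 0 < q) (hq1 : q < 1) (ha0 : 0 < q * a) (hb : q * b < 1)
    (k : ℕ) : 0 < littleQJacobiWeight q a b k := by
  have h1 := qShiftedFactorial_pos hq0 hq1 hb k
  have h2 := qShiftedFactorial_pos hq0 hq1 hq1 k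
  have h3 : 0 < (a * q) ^ k := pow_pos (by linarith) k
  unfold littleQJacobiWeight
  positivity

/-- `√w_k = √(aq)^k / ρ_k`, so that passing from functions on `q^ℕ` to `ℓ²` amounts to undoing the
symmetrization of the Al-Salam–Chihara recurrence. -/
theorem sqrt_littleQJacobiWeight (hq0 : 0 < q) (hq1 : q < 1) (ha0 : 0 < q * a) (hb : q * b < 1)
    (k : ℕ) : √(littleQJacobiWeight q a b k) * ascFactor q (q * b) k = √(a * q) ^ k := by
  have h1 := qShiftedFactorial_pos hq0 hq1 hb k
  have h2 := qShiftedFactorial_pos hq0 hq1 hq1 k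
  have h0 : 0 ≤ a * q := by linarith
  rw [ascFactor, ← Real.sqrt_mul (littleQJacobiWeight_pos hq0 hq1 ha0 hb k).le,
    littleQJacobiWeight, show qShiftedFactorial (q * b) q k / qShiftedFactorial q q k * (a * q) ^ k *
      (qShiftedFactorial q q k / qShiftedFactorial (q * b) q k) = (a * q) ^ k by field_simp]
  rw [← Real.sqrt_sq (pow_nonneg (Real.sqrt_nonneg (a * q)) k), ← pow_mul, mul_comm k, pow_mul,
    Real.sq_sqrt h0]

theorem sqrt_mul_ascOffDiag_mul_sqrt_weight (hq0 : 0 < q) (hq1 : q < 1) (ha0 : 0 < q * a)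
    (hb : q * b < 1) (k : ℕ) :
    √(a * q) * ascOffDiag q (q * b) k * √(littleQJacobiWeight q a b k) =
      (1 - q ^ (k + 1)) * √(littleQJacobiWeight q a b (k + 1)) := by
  have h1 := sqrt_littleQJacobiWeight hq0 hq1 ha0 hb k
  have h2 := sqrt_littleQJacobiWeight hq0 hq1 ha0 hb (k + 1)
  have h3 := ascOffDiag_mul_factor_succ hq0 hq1 hb k
  have h4 := ascFactor_pos hq0 hq1 hb k
  have h5 := ascFactor_pos hq0 hq1 hb (k + 1)
  refine mul_right_cancel₀ (mul_pos h4 h5).ne' ?_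
  linear_combination √(a * q) * ascOffDiag q (q * b) k * ascFactor q (q * b) (k + 1) * h1
    + √(a * q) ^ (k + 1) * h3 - (1 - q ^ (k + 1)) * ascFactor q (q * b) k * h2

theorem sqrt_mul_ascOffDiag_mul_sqrt_weight_succ (hq0 : 0 < q) (hq1 : q < 1) (ha0 : 0 < q * a)
    (hb : q * b < 1) (k : ℕ) :
    √(a * q) * ascOffDiag q (q * b) k * √(littleQJacobiWeight q a b (k + 1)) =
      a * q * (1 - b * q ^ (k + 1)) * √(littleQJacobiWeight q a b k) := by
  have h1 := sqrt_littleQJacobiWeight hq0 hq1 ha0 hb k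
  have h2 := sqrt_littleQJacobiWeight hq0 hq1 ha0 hb (k + 1)
  have h3 := ascOffDiag_mul_factor hq0 hq1 hb k
  have h4 := ascFactor_pos hq0 hq1 hb k
  have h5 := ascFactor_pos hq0 hq1 hb (k + 1)
  have h6 : √(a * q) ^ 2 = a * q := Real.sq_sqrt (by linarith)
  refine mul_right_cancel₀ (mul_pos h4 h5).ne' ?_
  linear_combination √(a * q) * ascOffDiag q (q * b) k * ascFactor q (q * b) k * h2
    + √(a * q) ^ (k + 2) * h3
    - a * q * (1 - b * q ^ (k + 1)) * ascFactor q (q * b) (k + 1) * h1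
    + √(a * q) ^ k * (1 - b * q ^ (k + 1)) * ascFactor q (q * b) (k + 1) * h6

theorem ae_littleQJacobiMeasure_iff (hw : ∀ k, 0 < littleQJacobiWeight q a b k) {P : ℝ → Prop} :
    (∀ᵐ x ∂littleQJacobiMeasure q a b, P x) ↔ ∀ k : ℕ, P (q ^ k) := by
  rw [littleQJacobiMeasure, Measure.ae_sum_iff]
  refine forall_congr' fun k => ?_
  rw [Measure.ae_ennreal_smul_measure_iff (ENNReal.ofReal_pos.2 (hw k)).ne', ae_dirac_eq,
    eventually_pure]

theorem littleQJacobiMeasure_singleton (hq0 : 0 < q) (hq1 : q < 1) (k : ℕ) :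
    littleQJacobiMeasure q a b {q ^ k} = ENNReal.ofReal (littleQJacobiWeight q a b k) := by
  rw [littleQJacobiMeasure, Measure.sum_apply _ (measurableSet_singleton _), tsum_eq_single k]
  · simp
  · intro j hj
    have : q ^ j ≠ q ^ k := fun h => hj (pow_right_injective₀ hq0 hq1.ne h)
    simp [this]

theorem littleQJacobiMeasure_singleton_ne_top (hq0 : 0 < q) (hq1 : q < 1) (k : ℕ) :
    littleQJacobiMeasure q a b {q ^ k} ≠ ∞ := by
  rw [littleQJacobiMeasure_singleton hq0 hq1]
  exact ENNReal.ofReal_ne_top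

theorem littleQJacobiMeasure_real_singleton (hq0 : 0 < q) (hq1 : q < 1)
    (hw : ∀ k, 0 < littleQJacobiWeight q a b k) (k : ℕ) :
    (littleQJacobiMeasure q a b).real {q ^ k} = littleQJacobiWeight q a b k := by
  rw [Measure.real, littleQJacobiMeasure_singleton hq0 hq1, ENNReal.toReal_ofReal (hw k).le]

/-- The normalized indicator functions of the atoms `q ^ k`. -/
noncomputable def atomVec (b : ℝ) (hq0 : 0 < q) (hq1 : q < 1) (k : ℕ) :
    Lp ℂ 2 (littleQJacobiMeasure q a b) :=
  ((√(littleQJacobiWeight q a b k) : ℝ) : ℂ)⁻¹ • indicatorConstLp 2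
    (measurableSet_singleton (q ^ k)) (littleQJacobiMeasure_singleton_ne_top hq0 hq1 k) (1 : ℂ)

theorem inner_atomVec (hq0 : 0 < q) (hq1 : q < 1) (hw : ∀ k, 0 < littleQJacobiWeight q a b k)
    (k : ℕ) (f : Lp ℂ 2 (littleQJacobiMeasure q a b)) :
    ⟪atomVec b hq0 hq1 k, f⟫_ℂ = (√(littleQJacobiWeight q a b k) : ℝ) * f (q ^ k) := by
  have h1 := Real.sqrt_pos.2 (hw k)
  rw [atomVec, inner_smul_left, L2.inner_indicatorConstLp_one, integral_singleton,
    littleQJacobiMeasure_real_singleton hq0 hq1 hw, map_inv₀, Complex.conj_ofReal,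
    Complex.real_smul, ← mul_assoc]
  congr 1
  rw [inv_mul_eq_iff_eq_mul₀ (Complex.ofReal_ne_zero.2 h1.ne')]
  exact_mod_cast (Real.mul_self_sqrt (hw k).le).symm

theorem orthonormal_atomVec (hq0 : 0 < q) (hq1 : q < 1)
    (hw : ∀ k, 0 < littleQJacobiWeight q a b k) :
    Orthonormal ℂ (atomVec (a := a) b hq0 hq1) := by
  rw [orthonormal_iff_ite]
  intro k j
  rw [atomVec, atomVec, inner_smul_left, inner_smul_right,
    L2.inner_indicatorConstLp_one_indicatorConstLp_one _ _
      (littleQJacobiMeasure_singleton_ne_top hq0 hq1 k)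
      (littleQJacobiMeasure_singleton_ne_top hq0 hq1 j)]
  split_ifs with h
  · subst h
    have h1 : ((√(littleQJacobiWeight q a b k) : ℝ) : ℂ) ≠ 0 :=
      Complex.ofReal_ne_zero.2 (Real.sqrt_pos.2 (hw k)).ne'
    have h2 : ((√(littleQJacobiWeight q a b k) : ℝ) : ℂ) *
        (√(littleQJacobiWeight q a b k) : ℝ) = littleQJacobiWeight q a b k := by
      exact_mod_cast Real.mul_self_sqrt (hw k).le
    rw [Set.inter_self, littleQJacobiMeasure_real_singleton hq0 hq1 hw, map_inv₀,
      Complex.conj_ofReal, inv_mul_eq_one₀ h1, eq_comm, inv_mul_eq_iff_eq_mul₀ h1]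
    exact h2.symm
  · have : ({q ^ k} ∩ {q ^ j} : Set ℝ) = ∅ := by
      rw [Set.singleton_inter_eq_empty, Set.mem_singleton_iff]
      exact fun hkj => h (pow_right_injective₀ hq0 hq1.ne hkj)
    simp [this]

/-- The normalized indicator functions of the atoms form a Hilbert basis of `L²(ν)`. -/
noncomputable def atomBasis (hq0 : 0 < q) (hq1 : q < 1)
    (hw : ∀ k, 0 < littleQJacobiWeight q a b k) :
    HilbertBasis ℕ ℂ (Lp ℂ 2 (littleQJacobiMeasure q a b)) :=
  HilbertBasis.mkOfOrthogonalEqBot (orthonormal_atomVec hq0 hq1 hw) (by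
    rw [Submodule.eq_bot_iff]
    intro f hf
    rw [Lp.eq_zero_iff_ae_eq_zero]
    refine (ae_littleQJacobiMeasure_iff hw).2 fun k => ?_
    have h := (Submodule.mem_orthogonal _ f).1 hf _ (Submodule.subset_span ⟨k, rfl⟩)
    rw [inner_atomVec hq0 hq1 hw] at h
    exact (mul_eq_zero.1 h).resolve_left
      (Complex.ofReal_ne_zero.2 (Real.sqrt_pos.2 (hw k)).ne'))

theorem atomBasis_repr_apply (hq0 : 0 < q) (hq1 : q < 1)
    (hw : ∀ k, 0 < littleQJacobiWeight q a b k) (f : Lp ℂ 2 (littleQJacobiMeasure q a b))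
    (k : ℕ) : (atomBasis hq0 hq1 hw).repr f k =
      (√(littleQJacobiWeight q a b k) : ℝ) * f (q ^ k) := by
  rw [HilbertBasis.repr_apply_apply, atomBasis, HilbertBasis.coe_mkOfOrthogonalEqBot,
    inner_atomVec hq0 hq1 hw]

end Weight

/-! ### Unitary equivalence with the Al-Salam–Chihara operator -/

section Transport

variable {H K : Type*} [NormedAddCommGroup H] [InnerProductSpace ℂ H] [NormedAddCommGroup K]
  [InnerProductSpace ℂ K] (e : H ≃ₗᵢ[ℂ] K)

/-- The operator on `H` unitarily equivalent, under `e : H ≃ K`, to an operator on `K`. -/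
noncomputable def pullOp (T : K →L[ℂ] K) : H →L[ℂ] H :=
  e.symm.toContinuousLinearEquiv.conjContinuousAlgEquiv T

theorem apply_pullOp (T : K →L[ℂ] K) (x : H) : e (pullOp e T x) = T (e x) := by
  simp [pullOp]

theorem spectrum_pullOp (T : K →L[ℂ] K) : spectrum ℂ (pullOp e T) = spectrum ℂ T :=
  AlgEquiv.spectrum_eq e.symm.toContinuousLinearEquiv.conjContinuousAlgEquiv T

theorem isSelfAdjoint_pullOp [CompleteSpace H] [CompleteSpace K] {T : K →L[ℂ] K}
    (hT : IsSelfAdjoint T) : IsSelfAdjoint (pullOp e T) := by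
  rw [isSelfAdjoint_iff_isSymmetric] at hT ⊢
  intro x y
  rw [← e.inner_map_map, ← e.inner_map_map x]
  simp only [coe_coe, apply_pullOp]
  exact hT (e x) (e y)

theorem hasSimpleSpectrum_pullOp {T : K →L[ℂ] K} (hT : HasSimpleSpectrum T) :
    HasSimpleSpectrum (pullOp e T) := by
  obtain ⟨ξ, hξ⟩ := hT
  refine ⟨e.symm ξ, ?_⟩
  have h1 : ∀ n : ℕ, (pullOp e T ^ n) (e.symm ξ) = e.symm ((T ^ n) ξ) := by
    intro n
    rw [pullOp, ← map_pow, ContinuousLinearEquiv.conjContinuousAlgEquiv_apply_apply]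
    exact congrArg (fun x => e.symm ((T ^ n) x)) (e.apply_symm_apply ξ)
  have h2 : (Set.range fun n : ℕ => (pullOp e T ^ n) (e.symm ξ)) =
      e.symm.toLinearEquiv.toLinearMap '' Set.range fun n : ℕ => (T ^ n) ξ := by
    rw [← Set.range_comp]
    simp only [h1]
    rfl
  rw [h2, Submodule.span_image, Submodule.map_coe]
  exact e.symm.surjective.denseRange.dense_image e.symm.continuous hξ

end Transport

theorem jacobiOp_affine (s d : SeqLInf) (κ σ : ℂ) :
    jacobiOp (-σ • s) (κ • (1 : SeqLInf) - σ • d) =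
      algebraMap ℂ (SeqL2 →L[ℂ] SeqL2) κ - σ • jacobiOp s d := by
  ext u (_ | k)
  · rw [sub_apply, seq_sub_apply, smul_apply, seq_smul_apply, jacobiOp_apply_zero,
      jacobiOp_apply_zero]
    simp [Algebra.algebraMap_eq_smul_one]
    ring
  · rw [sub_apply, seq_sub_apply, smul_apply, seq_smul_apply, jacobiOp_apply_succ,
      jacobiOp_apply_succ]
    simp [Algebra.algebraMap_eq_smul_one]
    ring

/-- The operator `κ - σ X` with `X` the Al-Salam–Chihara operator. For `κ = 1 + aq` and
`σ = √(aq)` it is the image of `T^γ` on `ℓ²`. -/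
noncomputable def affineAscOp {q : ℝ} (hq0 : 0 < q) (hq1 : q < 1) (p m κ σ : ℝ) :
    SeqL2 →L[ℂ] SeqL2 :=
  algebraMap ℂ (SeqL2 →L[ℂ] SeqL2) κ - (σ : ℂ) • ascOp hq0 hq1 p m

theorem isSelfAdjoint_affineAscOp {q : ℝ} (hq0 : 0 < q) (hq1 : q < 1) (p m κ σ : ℝ) :
    IsSelfAdjoint (affineAscOp hq0 hq1 p m κ σ) := by
  have h1 : IsSelfAdjoint (κ : ℂ) := Complex.conj_ofReal κ
  have h2 : IsSelfAdjoint (σ : ℂ) := Complex.conj_ofReal σ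
  exact (h1.algebraMap _).sub (h2.smul (isSelfAdjoint_ascOp hq0 hq1 p m))

theorem hasSimpleSpectrum_affineAscOp {q : ℝ} (hq0 : 0 < q) (hq1 : q < 1) {p : ℝ} (hp : p < 1)
    (m κ : ℝ) {σ : ℝ} (hσ : σ ≠ 0) : HasSimpleSpectrum (affineAscOp hq0 hq1 p m κ σ) := by
  refine ⟨seqUnit 0, ?_⟩
  rw [affineAscOp, ascOp, ← jacobiOp_affine]
  refine dense_span_jacobiOp_pow fun k => ?_
  rw [seq_smul_apply, convSeq_apply]
  exact mul_ne_zero (neg_ne_zero.2 (Complex.ofReal_ne_zero.2 hσ))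
    (Complex.ofReal_ne_zero.2 (ascOffDiag_pos hq0 hq1 hp k).ne')

theorem mem_spectrum_affineAscOp_iff {q : ℝ} (hq0 : 0 < q) (hq1 : q < 1) (p m κ : ℝ) {σ : ℝ}
    (hσ : σ ≠ 0) (t : ℂ) : t ∈ spectrum ℂ (affineAscOp hq0 hq1 p m κ σ) ↔
      ∃ lam ∈ spectrum ℂ (ascOp hq0 hq1 p m), t = κ - σ * lam := by
  have h1 : (σ : ℂ) • ascOp hq0 hq1 p m =
      Units.mk0 (σ : ℂ) (Complex.ofReal_ne_zero.2 hσ) • ascOp hq0 hq1 p m := rfl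
  rw [affineAscOp, ← spectrum.singleton_sub_eq, h1, spectrum.unit_smul_eq_smul,
    Set.singleton_sub, Set.mem_image]
  constructor
  · rintro ⟨_, ⟨lam, hlam, rfl⟩, rfl⟩
    exact ⟨lam, hlam, rfl⟩
  · rintro ⟨lam, hlam, rfl⟩
    exact ⟨_, ⟨lam, hlam, rfl⟩, rfl⟩

/-- Under the unitary map `f ↦ (√w_k f(q ^ k))_k` the operator `T^γ` corresponds to
`1 + aq - √(aq) X`, with `X` the Al-Salam–Chihara operator. -/
theorem pullOp_ae_eq_qDifferenceOp {q a b γ m : ℝ} (hq0 : 0 < q) (hq1 : q < 1) (ha0 : 0 < q * a)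
    (hb : q * b < 1) (hw : ∀ k, 0 < littleQJacobiWeight q a b k)
    (hm : √(a * q) * m = 1 + a * b * q ^ 2 - γ) (f : Lp ℂ 2 (littleQJacobiMeasure q a b)) :
    ⇑(pullOp (atomBasis hq0 hq1 hw).repr
      (affineAscOp hq0 hq1 (q * b) m (1 + a * q) √(a * q)) f) =ᵐ[littleQJacobiMeasure q a b]
      qDifferenceOp q a b γ ⇑f := by
  refine (ae_littleQJacobiMeasure_iff hw).2 fun k => ?_
  set T := affineAscOp hq0 hq1 (q * b) m (1 + a * q) √(a * q) with hT
  set U := (atomBasis hq0 hq1 hw).repr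
  set W : ℕ → ℂ := fun k => (√(littleQJacobiWeight q a b k) : ℝ) with hW
  have hW0 : ∀ k, W k ≠ 0 := fun k => Complex.ofReal_ne_zero.2 (Real.sqrt_pos.2 (hw k)).ne'
  have hrepr : ∀ (g : Lp ℂ 2 (littleQJacobiMeasure q a b)) k, U g k = W k * g (q ^ k) :=
    fun g k => atomBasis_repr_apply hq0 hq1 hw g k
  refine mul_left_cancel₀ (hW0 k) ?_
  rw [← hrepr, apply_pullOp, hT, affineAscOp, sub_apply, seq_sub_apply, smul_apply, seq_smul_apply]
  have halg : ∀ j, (algebraMap ℂ (SeqL2 →L[ℂ] SeqL2) ((1 + a * q : ℝ) : ℂ)) (U f) j =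
      ((1 + a * q : ℝ) : ℂ) * U f j := by
    intro j
    simp [Algebra.algebraMap_eq_smul_one]
  have hW1 : ∀ k, ((√(a * q) : ℝ) : ℂ) * ascOffDiag q (q * b) k * W k =
      (1 - (q : ℂ) ^ (k + 1)) * W (k + 1) := fun k => by
    simp only [hW]
    exact_mod_cast sqrt_mul_ascOffDiag_mul_sqrt_weight hq0 hq1 ha0 hb k
  have hW2 : ∀ k, ((√(a * q) : ℝ) : ℂ) * ascOffDiag q (q * b) k * W (k + 1) =
      a * q * (1 - b * (q : ℂ) ^ (k + 1)) * W k := fun k => by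
    simp only [hW]
    exact_mod_cast sqrt_mul_ascOffDiag_mul_sqrt_weight_succ hq0 hq1 ha0 hb k
  have hm' : ((√(a * q) : ℝ) : ℂ) * m = 1 + a * b * (q : ℂ) ^ 2 - γ := by exact_mod_cast hm
  rw [halg]
  rcases k with _ | k
  · rw [ascOp, jacobiOp_apply_zero, hrepr, hrepr, convSeq_apply, convSeq_apply, qDifferenceOp]
    have := hW2 0
    simp only [zero_add, pow_one, pow_zero, mul_one, sub_self] at this ⊢
    push_cast
    linear_combination -f q * this - W 0 * f 1 * hm'
  · rw [ascOp, jacobiOp_apply_succ, hrepr, hrepr, hrepr, convSeq_apply, convSeq_apply,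
      convSeq_apply, qDifferenceOp,
      show q * q ^ (k + 1) = q ^ (k + 2) by ring,
      show q⁻¹ * q ^ (k + 1) = q ^ k by rw [pow_succ', inv_mul_cancel_left₀ hq0.ne']]
    have h1 := hW1 k
    have h2 := hW2 (k + 1)
    push_cast
    linear_combination -f (q ^ k) * h1 - f (q ^ (k + 2)) * h2
      - W (k + 1) * f (q ^ (k + 1)) * (q : ℂ) ^ (k + 1) * hm'

/-! ### The spectrum in the original parameters -/

/-- The unit circle in the variable `z` corresponds to the interval of continuous spectrum. -/
theorem mem_image_Icc_iff {σ : ℝ} (hσ : 0 < σ) (t : ℂ) :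
    t ∈ (fun x : ℝ => (x : ℂ)) '' Set.Icc ((1 - σ) ^ 2) ((1 + σ) ^ 2) ↔
      ∃ z : ℂ, ‖z‖ = 1 ∧ t = (1 + σ ^ 2 : ℝ) - σ * (z + z⁻¹) := by
  constructor
  · rintro ⟨x, ⟨h1, h2⟩, rfl⟩
    set y := (1 + σ ^ 2 - x) / (2 * σ)
    have hy : 2 * σ * y = 1 + σ ^ 2 - x := by
      simp only [y]
      field_simp
    have hy1 : -1 ≤ y := by
      rw [le_div_iff₀ (by positivity)]
      nlinarith
    have hy2 : y ≤ 1 := by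
      rw [div_le_iff₀ (by positivity)]
      nlinarith
    have hcos : Complex.exp (Real.arccos y * Complex.I) +
        (Complex.exp (Real.arccos y * Complex.I))⁻¹ = 2 * y := by
      rw [← Complex.exp_neg, ← neg_mul, ← Complex.two_cos, ← Complex.ofReal_cos,
        Real.cos_arccos hy1 hy2]
    refine ⟨Complex.exp (Real.arccos y * Complex.I), Complex.norm_exp_ofReal_mul_I _, ?_⟩
    rw [hcos]
    have hy' : 2 * (σ : ℂ) * y = 1 + (σ : ℂ) ^ 2 - x := by exact_mod_cast hy
    push_cast
    linear_combination hy'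
  · rintro ⟨z, hz, rfl⟩
    have hinv : z + z⁻¹ = (2 * z.re : ℝ) := by
      rw [Complex.inv_eq_conj hz, Complex.add_conj]
    have h1 := abs_le.1 ((Complex.abs_re_le_norm z).trans_eq hz)
    refine ⟨1 + σ ^ 2 - σ * (2 * z.re), ⟨by nlinarith [h1.2], by nlinarith [h1.1]⟩, ?_⟩
    rw [hinv]
    push_cast
    ring

/-- The discrete part contributed by the parameter `α`. -/
theorem exists_root_iff {α q : ℂ} {σ κ : ℝ} (t : ℂ) :
    (∃ z : ℂ, ‖z‖ < 1 ∧ (∃ k : ℕ, α * z * q ^ k = 1) ∧ t = κ - σ * (z + z⁻¹)) ↔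
      ∃ k : ℕ, 1 < ‖q ^ k * α‖ ∧ t = κ - σ * ((q ^ k * α)⁻¹ + q ^ k * α) := by
  constructor
  · rintro ⟨z, hz, ⟨k, hk⟩, rfl⟩
    have h1 : q ^ k * α * z = 1 := by linear_combination hk
    have hz0 : z ≠ 0 := right_ne_zero_of_mul_eq_one h1
    have h2 : q ^ k * α = z⁻¹ := eq_inv_of_mul_eq_one_left h1
    refine ⟨k, ?_, ?_⟩
    · rw [h2, norm_inv]
      exact (one_lt_inv₀ (norm_pos_iff.2 hz0)).2 hz
    · rw [h2, inv_inv]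
  · rintro ⟨k, hk, rfl⟩
    have h0 : q ^ k * α ≠ 0 := norm_pos_iff.1 (one_pos.trans hk)
    refine ⟨(q ^ k * α)⁻¹, ?_, ⟨k, ?_⟩, by rw [inv_inv]⟩
    · rw [norm_inv]
      exact inv_lt_one_of_one_lt₀ hk
    · rw [mul_right_comm, mul_comm α, mul_inv_cancel₀ h0]

theorem mainTheorem2 (q a b γ : ℝ) (c : ℂ) (hq0 : 0 < q) (hq1 : q < 1)
    (ha0 : 0 < q * a) (ha1 : q * a < 1) (hb : b < q⁻¹) (hc : c ≠ 0)
    (hγ : (γ : ℂ) = (1 + a * b * q ^ 2) - (a * c * q + b * q / c))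
    (hΛ : ∀ n : ℕ, 0 < littleQJacobiEigenvalue q (a * q) b n + γ) :
    ∃ T : Lp ℂ 2 (littleQJacobiMeasure q a b) →L[ℂ] Lp ℂ 2 (littleQJacobiMeasure q a b),
      (∀ f : Lp ℂ 2 (littleQJacobiMeasure q a b),
        ⇑(T f) =ᵐ[littleQJacobiMeasure q a b] qDifferenceOp q a b γ ⇑f) ∧
      IsSelfAdjoint T ∧
      HasSimpleSpectrum T ∧
      spectrum ℂ T =
        (fun t : ℝ => (t : ℂ)) ''
            Set.Icc ((1 - Real.sqrt (a * q)) ^ 2) ((1 + Real.sqrt (a * q)) ^ 2) ∪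
          {z : ℂ | ∃ k : ℕ, 1 < ‖(q : ℂ) ^ k * c * (Real.sqrt (a * q) : ℂ)‖ ∧
            z = (1 - ((q : ℂ) ^ k)⁻¹ / c) * (1 - a * c * (q : ℂ) ^ (1 + k))} ∪
          {z : ℂ | ∃ l : ℕ, 1 < ‖(q : ℂ) ^ l * (b / c) * (Real.sqrt (q / a) : ℂ)‖ ∧
            z = (1 - b * (q : ℂ) ^ (l + 1) / c) * (1 - a * c * ((q : ℂ) ^ l)⁻¹ / b)} := by
  have ha : 0 < a := pos_of_mul_pos_right ha0 hq0.le
  have hb' : q * b < 1 := by rwa [← one_div, lt_div_iff₀' hq0] at hb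
  have hw := littleQJacobiWeight_pos hq0 hq1 ha0 hb'
  set σ := √(a * q) with hσdef
  have hσ : 0 < σ := Real.sqrt_pos.2 (by positivity)
  have hσ2 : σ ^ 2 = a * q := Real.sq_sqrt (by positivity)
  have hτ : √(q / a) = q / σ := by
    rw [← Real.sqrt_sq (div_pos hq0 hσ).le, div_pow, hσ2]
    congr 1
    field_simp
  have hσC : (σ : ℂ) ≠ 0 := Complex.ofReal_ne_zero.2 hσ.ne'
  have hqC : (q : ℂ) ≠ 0 := Complex.ofReal_ne_zero.2 hq0.ne'
  have haC : (a : ℂ) ≠ 0 := Complex.ofReal_ne_zero.2 ha.ne'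
  have hσ2C : (σ : ℂ) ^ 2 = a * q := by exact_mod_cast hσ2
  -- the Al-Salam–Chihara parameters
  set α : ℂ := c * σ
  set β : ℂ := b / c * (√(q / a) : ℝ) with hβ
  have hβ' : β = b / c * (q / σ) := by rw [hβ, hτ]; push_cast; rfl
  set m : ℝ := (1 + a * b * q ^ 2 - γ) / σ
  have hm : σ * m = 1 + a * b * q ^ 2 - γ := by
    simp only [m]
    field_simp
  have hαβ : α * β = (q * b : ℝ) := by
    rw [hβ']
    simp only [α]
    push_cast
    field_simp
  have hsum : α + β = m := by
    have h1 : (σ : ℂ) * m = 1 + a * b * (q : ℂ) ^ 2 - γ := by exact_mod_cast hm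
    refine mul_left_cancel₀ hσC ?_
    rw [h1, hγ, hβ']
    have h2 : (σ : ℂ) * (α + b / c * (q / σ)) = c * (σ : ℂ) ^ 2 + b * q / c := by
      simp only [α]
      field_simp
    rw [h2, hσ2C]
    ring
  refine ⟨pullOp (atomBasis hq0 hq1 hw).repr (affineAscOp hq0 hq1 (q * b) m (1 + a * q) σ),
    pullOp_ae_eq_qDifferenceOp hq0 hq1 ha0 hb' hw hm,
    isSelfAdjoint_pullOp _ (isSelfAdjoint_affineAscOp hq0 hq1 _ _ _ _),
    hasSimpleSpectrum_pullOp _ (hasSimpleSpectrum_affineAscOp hq0 hq1 hb' _ _ hσ.ne'), ?_⟩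
  rw [spectrum_pullOp]
  ext t
  have hα_set : (∃ k : ℕ, 1 < ‖(q : ℂ) ^ k * c * (σ : ℂ)‖ ∧
      t = (1 - ((q : ℂ) ^ k)⁻¹ / c) * (1 - a * c * (q : ℂ) ^ (1 + k))) ↔
      ∃ z : ℂ, ‖z‖ < 1 ∧ (∃ k : ℕ, α * z * (q : ℂ) ^ k = 1) ∧
        t = ((1 + a * q : ℝ) : ℂ) - σ * (z + z⁻¹) := by
    rw [exists_root_iff]
    refine exists_congr fun k => ?_
    rw [mul_assoc]
    refine and_congr_right fun _ => Eq.congr_right ?_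
    simp only [α]
    push_cast
    have : (σ : ℂ) * (((q : ℂ) ^ k * (c * σ))⁻¹ + (q : ℂ) ^ k * (c * σ)) =
        ((q : ℂ) ^ k)⁻¹ / c + (q : ℂ) ^ k * c * (σ : ℂ) ^ 2 := by
      field_simp
    rw [this, hσ2C]
    field_simp
    ring
  have hβ_set : (∃ l : ℕ, 1 < ‖(q : ℂ) ^ l * (b / c) * (√(q / a) : ℝ)‖ ∧
      t = (1 - b * (q : ℂ) ^ (l + 1) / c) * (1 - a * c * ((q : ℂ) ^ l)⁻¹ / b)) ↔
      ∃ z : ℂ, ‖z‖ < 1 ∧ (∃ k : ℕ, β * z * (q : ℂ) ^ k = 1) ∧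
        t = ((1 + a * q : ℝ) : ℂ) - σ * (z + z⁻¹) := by
    rw [exists_root_iff]
    refine exists_congr fun l => ?_
    rw [mul_assoc]
    refine and_congr_right fun hl => Eq.congr_right ?_
    -- the norm condition excludes `b = 0`, so that the division by `b` is genuine
    have hb0 : (b : ℂ) ≠ 0 := by
      intro h0
      rw [h0, zero_div, zero_mul, mul_zero, norm_zero] at hl
      exact absurd hl (by norm_num)
    rw [hβ']
    push_cast
    have : (σ : ℂ) * (((q : ℂ) ^ l * (b / c * (q / σ)))⁻¹ + (q : ℂ) ^ l * (b / c * (q / σ))) =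
        (σ : ℂ) ^ 2 * c / ((q : ℂ) ^ l * b * q) + (q : ℂ) ^ l * b * q / c := by
      field_simp
    rw [this, hσ2C]
    field_simp
    ring
  rw [Set.mem_union, Set.mem_union, Set.mem_ofPred_eq, Set.mem_ofPred_eq, hα_set, hβ_set,
    mem_image_Icc_iff hσ, hσ2, mem_spectrum_affineAscOp_iff hq0 hq1 _ _ _ hσ.ne']
  simp only [mem_spectrum_ascOp_iff hq0 hq1 hb' hsum hαβ]
  constructor
  · rintro ⟨_, ⟨z, hz, rfl⟩ | ⟨z, hz, rfl, k, hk | hk⟩, rfl⟩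
    · exact Or.inl (Or.inl ⟨z, hz, rfl⟩)
    · exact Or.inl (Or.inr ⟨z, hz, ⟨k, hk⟩, rfl⟩)
    · exact Or.inr ⟨z, hz, ⟨k, hk⟩, rfl⟩
  · rintro ((⟨z, hz, rfl⟩ | ⟨z, hz, ⟨k, hk⟩, rfl⟩) | ⟨z, hz, ⟨k, hk⟩, rfl⟩)
    · exact ⟨_, Or.inl ⟨z, hz, rfl⟩, rfl⟩
    · exact ⟨_, Or.inr ⟨z, hz, rfl, k, Or.inl hk⟩, rfl⟩
    · exact ⟨_, Or.inr ⟨z, hz, rfl, k, Or.inr hk⟩, rfl⟩
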